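/- Conventions. On a surface $M$ with a metric, the segment of two points is the unique minimal geodesic joining them (if the minimal geodesic is unique). A polygon is a region homeomorphic to a closed disc whose boundary is a closed chain of segments between consecutive vertices, which meet only in common endpoints. An admissible diagonal is a segment between two non-consecutive vertices contained in the polygon. A triangulation of a polygon is a set of admissible diagonals, meeting each other and the sides only in common endpoints, which partitions the polygon into triangular regions (regions homeomorphic to a disc and bounded by three segments). A triangulation of a point set is a maximal set of segments between its points, meeting only in common endpoints and containing no further point of the set, such that each bounded region is triangular. A flip removes an edge $ab$ common to two triangles $abc$ and $abd$ and inserts the segment $cd$, provided that it is contained in the quadrangle formed by the two triangles. In the case of a polygon only diagonals are flipped. The graph of triangulations has the triangulations as nodes and the flips as edges. **Lemma 3.1.** Let $\mathbb S^2\subset\mathbb R^3$ be the unit sphere, let $n\in \mathbb S^2$, and let $U\subset\mathbb R^3$ be a neighbourhood of $n$. There is a smooth function $\rho:\mathbb R^3\to[1,\infty)$ with $\rho(n)>1$ and $\rho=1$ outside $U$ such that the surface $M=\{\rho(x)x : x\in \mathbb S^2\}$ with its intrinsic metric (the infimum of the lengths of the curves in $M$ joining two points), which is homeomorphic to $\mathbb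 S^2$ by $\rho(x)x\mapsto x$, has the following properties. 1. In $M$ there is a polygon $P$ with six vertices, lying over the open hemisphere $\{x\in\mathbb S^2:\langle n,x\rangle>0\}$, that has exactly two triangulations. Neither of them admits a flip to a triangulation of $P$. Hence the graph of triangulations of $P$ is not connected. 2. The set of seven points consisting of the vertices of $P$ and of the point of $M$ over $-n$ also has exactly two triangulations. Neither of them admits a flip to a triangulation of this set. Hence its graph of triangulations is not connected. -/

import Mathlib

open Set Topology
open scoped ContDiff

namespace FlipGraph

/-! ### Segments, polygons, triangulations and flips on a surface with a metric -/

section Surface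

variable {M : Type*} [MetricSpace M]

/-- `s` is (the trace of) a minimal geodesic from `a` to `b`: a curve from `a` to `b` parametrized
by arc length whose length is the distance from `a` to `b`. -/
def IsMinGeodesic (a b : M) (s : Set M) : Prop :=
  ∃ γ : ℝ → M, γ 0 = a ∧ γ (dist a b) = b ∧
    (∀ t ∈ Icc 0 (dist a b), ∀ u ∈ Icc 0 (dist a b), dist (γ t) (γ u) = |t - u|) ∧
    s = γ '' Icc 0 (dist a b)

/-- `s` is the segment defined by `a` and `b`: the unique minimal geodesic joining them. -/
def IsSegment (a b : M) (s : Set M) : Prop :=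
  IsMinGeodesic a b s ∧ ∀ s', IsMinGeodesic a b s' → s' = s

/-- Two different segments of the family `E` meet at most in common endpoints. -/
def NonCrossing (E : Set (Set M)) : Prop :=
  ∀ s ∈ E, ∀ t ∈ E, s ≠ t → ∀ a b c d : M, IsSegment a b s → IsSegment c d t →
    s ∩ t ⊆ {a, b} ∩ {c, d}

/-- `R` is homeomorphic to the closed unit disc. -/
def IsDisc (R : Set M) : Prop :=
  Nonempty (R ≃ₜ Metric.closedBall (0 : EuclideanSpace ℝ (Fin 2)) 1)

/-- The faces cut out of the region `X` by the points `S` and the segments `E`: the connected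
components of what remains of `X`. -/
def faces (X S : Set M) (E : Set (Set M)) : Set (Set M) :=
  {C | ∃ x ∈ X \ (S ∪ ⋃₀ E), C = connectedComponentIn (X \ (S ∪ ⋃₀ E)) x}

/-- The face `C` is triangular with vertices `a`, `b`, `c`: its closure is a disc, and its
boundary consists of three segments of `E` joining the three different points `a`, `b`, `c`. -/
def IsTriangle (E : Set (Set M)) (a b c : M) (C : Set M) : Prop :=
  a ≠ b ∧ b ≠ c ∧ c ≠ a ∧ IsDisc (closure C) ∧
    ∃ s ∈ E, ∃ t ∈ E, ∃ u ∈ E, IsSegment a b s ∧ IsSegment b c t ∧ IsSegment c a u ∧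
      frontier C = s ∪ t ∪ u

/-- In the region `X`, with vertex set `S` and fixed edges `B`, the set of edges `T'` arises from
`T` by a flip: an edge `e = ab` of `T` common to two triangular faces `abc` and `abd` is replaced
by the segment `f = cd`, which has to be contained in the quadrangle formed by the two faces. -/
def IsFlip (X S : Set M) (B T T' : Set (Set M)) : Prop :=
  ∃ (a b c d : M) (e f C D : Set M),
    e ∈ T ∧ IsSegment a b e ∧
    C ∈ faces X S (B ∪ T) ∧ D ∈ faces X S (B ∪ T) ∧ C ≠ D ∧
    IsTriangle (B ∪ T) a b c C ∧ IsTriangle (B ∪ T) a b d D ∧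
    c ≠ d ∧ IsSegment c d f ∧ f ⊆ closure C ∪ closure D ∧
    T' = insert f (T \ {e})

/-- The sides of the closed polygonal chain with vertices `v 0, …, v (n - 1)`
(indices are taken modulo `n`). -/
def sides {n : ℕ} [NeZero n] (v : Fin n → M) : Set (Set M) :=
  {s | ∃ i, IsSegment (v i) (v (i + 1)) s}

/-- `R` is a polygon with the successive vertices `v 0, …, v (n - 1)`: a region homeomorphic to a
closed disc whose boundary consists of the `n` segments joining consecutive vertices. -/
structure IsPolygon {n : ℕ} [NeZero n] (v : Fin n → M) (R : Set M) : Prop where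
  three_le : 3 ≤ n
  injective : Function.Injective v
  exists_side : ∀ i, ∃ s, IsSegment (v i) (v (i + 1)) s
  nonCrossing : NonCrossing (sides v)
  isDisc : IsDisc R
  frontier_eq : frontier R = ⋃₀ sides v

/-- `s` is an admissible diagonal of the polygon: a segment between two non-consecutive vertices
that is contained in the polygon. -/
def IsAdmissibleDiagonal {n : ℕ} [NeZero n] (v : Fin n → M) (R s : Set M) : Prop :=
  ∃ i j, i ≠ j ∧ j ≠ i + 1 ∧ i ≠ j + 1 ∧ IsSegment (v i) (v j) s ∧ s ⊆ R

/-- `T` is the set of diagonals of a triangulation of the polygon: admissible diagonals that meet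
each other and the sides at most in common endpoints and partition the polygon into triangular
regions. -/
structure IsPolygonTriangulation {n : ℕ} [NeZero n] (v : Fin n → M) (R : Set M)
    (T : Set (Set M)) : Prop where
  admissible : ∀ s ∈ T, IsAdmissibleDiagonal v R s
  nonCrossing : NonCrossing (sides v ∪ T)
  triangular : ∀ C ∈ faces R (range v) (sides v ∪ T), ∃ a b c, IsTriangle (sides v ∪ T) a b c C

/-- `T` is a set of non-crossing segments between different points of `S`, none of which passes
through a further point of `S`. -/
def IsSegmentSystem (S : Set M) (T : Set (Set M)) : Prop :=
  (∀ s ∈ T, ∃ a ∈ S, ∃ b ∈ S, a ≠ b ∧ IsSegment a b s ∧ s ∩ S = {a, b}) ∧ NonCrossing T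

/-- `T` is the set of edges of a triangulation of the point set `S`: a maximal set of non-crossing
segments such that each bounded region is triangular. -/
structure IsPointSetTriangulation (S : Set M) (T : Set (Set M)) : Prop where
  maximal : Maximal (IsSegmentSystem S) T
  triangular : ∀ C ∈ faces univ S T, Bornology.IsBounded C → ∃ a b c, IsTriangle T a b c C

/-- The graph of triangulations of a polygon: adjacency is a flip of a diagonal. -/
def polygonTG {n : ℕ} [NeZero n] (v : Fin n → M) (R : Set M) :
    SimpleGraph {T : Set (Set M) // IsPolygonTriangulation v R T} :=
  SimpleGraph.fromRel fun T T' => IsFlip R (range v) (sides v) T.1 T'.1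

/-- The graph of triangulations of a point set: adjacency is a flip of an edge. -/
def pointSetTG (S : Set M) : SimpleGraph {T : Set (Set M) // IsPointSetTriangulation S T} :=
  SimpleGraph.fromRel fun T T' => IsFlip univ S ∅ T.1 T'.1

end Surface

/-! ### The sphere with a bump -/

/-- Euclidean 3-space. -/
abbrev E3 : Type := EuclideanSpace ℝ (Fin 3)

/-- The unit sphere in Euclidean 3-space. -/
abbrev S2 : Type := Metric.sphere (0 : E3) 1

/-- A smooth height function `ρ ≥ 1` that raises the point `n` and leaves every point outside `U`
where it is. -/
structure IsBump (n : S2) (U : Set E3) (ρ : E3 → ℝ) : Prop where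
  contDiff : ContDiff ℝ ∞ ρ
  one_le : ∀ x, 1 ≤ ρ x
  one_lt : 1 < ρ n
  eq_one : ∀ x, x ∉ U → ρ x = 1

/-- The point of the raised sphere above the point `x` of the unit sphere. -/
def raise (ρ : E3 → ℝ) (x : S2) : E3 := ρ x • (x : E3)

/-- The intrinsic distance in a subset `A` of 3-space: the infimum of the lengths of the curves
that join the two points inside `A`. -/
noncomputable def intrinsicEDist (A : Set E3) (p q : E3) : ENNReal :=
  ⨅ γ ∈ {γ : ℝ → E3 | ContinuousOn γ (Icc 0 1) ∧ MapsTo γ (Icc 0 1) A ∧ γ 0 = p ∧ γ 1 = q},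
    eVariationOn γ (Icc 0 1)

end FlipGraph

open FlipGraph

/-! Six vertices surround `n`, and a tall, narrow, rotationally symmetric bump sits at `n`, so small
that it misses every side, every short diagonal (joining vertices two apart) and every arc from a
vertex to the pole `-n`. The surface lies outside the open unit ball. Radial projection to the
sphere does not lengthen curves there, so intrinsic distance is at least spherical distance. Hence
each of these great circle arcs is still the unique minimal geodesic between its ends.

Opposite vertices define no segment. The reflection in the plane through them and `n` is an isometry
of the surface. It would map a unique minimal geodesic to itself pointwise, so the geodesic would
lie in that plane and pass over `n` or through `-n`. Climbing the bump is too long, and so is the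
detour through `-n`, since three successive sides are shorter than `3π/2`.

So only sides, short diagonals and spokes to the pole are available, and two of them cross exactly
when they are short diagonals from successive vertices. In any triangulation the face at `n` is
bounded by a cycle of three edges. Unless this is one of the two central triangles, it misses the
arc from `n` to some vertex. That arc leads out of the face and must meet its boundary, a
contradiction. A central triangle excludes the other three diagonals, so there are exactly two
triangulations. They differ in three diagonals, while a flip removes only one edge.

The carriers are `angle_le_eVariationOn`, `isSegment_of_height_eq_one`, `not_isSegment_opposite`,
`exists_diag_of_isTriangle` and `card_and_flipGraph_eq_bot`. Incidences are checked with linear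
functionals on 3-space, as all regions are cones cut with the sphere. -/

namespace FlipGraph

/-! ### Intrinsic distance in a subset of space -/

section Intrinsic

variable {A : Set E3} {p q r : E3}

theorem intrinsicEDist_le_eVariationOn {γ : ℝ → E3} (hc : ContinuousOn γ (Icc 0 1))
    (hm : MapsTo γ (Icc 0 1) A) : intrinsicEDist A (γ 0) (γ 1) ≤ eVariationOn γ (Icc 0 1) :=
  iInf₂_le γ ⟨hc, hm, rfl, rfl⟩

theorem edist_le_intrinsicEDist : edist p q ≤ intrinsicEDist A p q := by
  refine le_iInf₂ fun γ hγ => ?_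
  obtain ⟨-, -, rfl, rfl⟩ := hγ
  exact eVariationOn.edist_le _ (by simp) (by simp)

theorem intrinsicEDist_self (hp : p ∈ A) : intrinsicEDist A p p = 0 := by
  refine le_antisymm ?_ zero_le
  refine (intrinsicEDist_le_eVariationOn (A := A) (γ := fun _ => p) continuousOn_const
    fun _ _ => hp).trans_eq ?_
  exact eVariationOn.constant_on (by rintro _ ⟨_, _, rfl⟩ _ ⟨_, _, rfl⟩; rfl)

theorem intrinsicEDist_comm_le : intrinsicEDist A p q ≤ intrinsicEDist A q p := by
  refine le_iInf₂ fun γ hγ => ?_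
  obtain ⟨hc, hm, rfl, rfl⟩ := hγ
  have hφ : MapsTo (fun t : ℝ => 1 - t) (Icc 0 1) (Icc 0 1) := fun t ht => by
    simp only [mem_Icc] at ht ⊢; constructor <;> linarith
  have := intrinsicEDist_le_eVariationOn (A := A) (γ := fun t => γ (1 - t))
    (hc.comp (by fun_prop) hφ) (hm.comp hφ)
  simp only [sub_zero, sub_self] at this
  refine this.trans ?_
  exact eVariationOn.comp_le_of_antitoneOn γ (fun t : ℝ => 1 - t)
    (fun a _ b _ h => sub_le_sub_left h 1) hφ

theorem intrinsicEDist_comm : intrinsicEDist A p q = intrinsicEDist A q p :=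
  le_antisymm intrinsicEDist_comm_le intrinsicEDist_comm_le

/-- Concatenate two curves, each run at double speed; variation is additive at `1 / 2`. In the
infima, maps that are not admissible curves contribute `⊤`. -/
theorem intrinsicEDist_triangle :
    intrinsicEDist A p r ≤ intrinsicEDist A p q + intrinsicEDist A q r := by
  unfold intrinsicEDist
  rw [ENNReal.iInf_add]
  refine le_iInf fun γ => ?_
  by_cases hγ : γ ∈ {γ : ℝ → E3 | ContinuousOn γ (Icc 0 1) ∧ MapsTo γ (Icc 0 1) A ∧ γ 0 = p ∧
      γ 1 = q}
  swap
  · simp [hγ]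
  rw [iInf_pos hγ, ENNReal.add_iInf]
  refine le_iInf fun δ => ?_
  by_cases hδ : δ ∈ {γ : ℝ → E3 | ContinuousOn γ (Icc 0 1) ∧ MapsTo γ (Icc 0 1) A ∧ γ 0 = q ∧
      γ 1 = r}
  swap
  · simp [hδ]
  rw [iInf_pos hδ]
  obtain ⟨hc, hm, rfl, rfl⟩ := hγ
  obtain ⟨hc', hm', h01, rfl⟩ := hδ
  set η : ℝ → E3 := fun t => if t ≤ 1 / 2 then γ (2 * t) else δ (2 * t - 1) with hη
  have e1 : EqOn η (fun t => γ (2 * t)) (Icc 0 (1 / 2)) := fun t ht => by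
    simp only [hη]; rw [if_pos ht.2]
  have e2 : EqOn η (fun t => δ (2 * t - 1)) (Icc (1 / 2) 1) := fun t ht => by
    simp only [hη]
    rcases ht.1.eq_or_lt with h | h
    · rw [if_pos h.symm.le, ← h]; norm_num [h01]
    · rw [if_neg (not_le.2 h)]
  have m1 : MapsTo (fun t : ℝ => 2 * t) (Icc 0 (1 / 2)) (Icc 0 1) := fun t ht => by
    simp only [mem_Icc] at ht ⊢; constructor <;> linarith
  have m2 : MapsTo (fun t : ℝ => 2 * t - 1) (Icc (1 / 2) 1) (Icc 0 1) := fun t ht => by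
    simp only [mem_Icc] at ht ⊢; constructor <;> linarith
  have hu : Icc (0 : ℝ) 1 = Icc 0 (1 / 2) ∪ Icc (1 / 2) 1 :=
    (Icc_union_Icc_eq_Icc (by norm_num) (by norm_num)).symm
  have c1 : ContinuousOn η (Icc 0 (1 / 2)) := (hc.comp (by fun_prop) m1).congr e1
  have c2 : ContinuousOn η (Icc (1 / 2) 1) := (hc'.comp (by fun_prop) m2).congr e2
  have h : intrinsicEDist A (η 0) (η 1) ≤ eVariationOn η (Icc 0 1) := by
    apply intrinsicEDist_le_eVariationOn
    · rw [hu]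
      exact c1.union_of_isClosed c2 isClosed_Icc isClosed_Icc
    · rw [hu]
      rintro t (ht | ht)
      · rw [e1 ht]; exact hm (m1 ht)
      · rw [e2 ht]; exact hm' (m2 ht)
  have h0 : η 0 = γ 0 := by simp [hη]
  have h1 : η 1 = δ 1 := by norm_num [hη]
  rw [h0, h1] at h
  refine h.trans ?_
  have := eVariationOn.Icc_add_Icc η (s := univ) (a := (0 : ℝ)) (b := 1 / 2) (c := 1)
    (by norm_num) (by norm_num) trivial
  simp only [univ_inter] at this
  rw [← this, eVariationOn.congr e1, eVariationOn.congr e2]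
  gcongr
  · exact eVariationOn.comp_le_of_monotoneOn γ (fun t : ℝ => 2 * t)
      (fun a _ b _ h => by simpa using h) m1
  · exact eVariationOn.comp_le_of_monotoneOn δ (fun t : ℝ => 2 * t - 1)
      (fun a _ b _ h => by simpa using h) m2

/-- Rescaling `[0, L]` to `[0, 1]` gives a competitor of length at most `K * L`. All upper bounds on
distances along explicit arcs come from here. -/
theorem intrinsicEDist_le_of_lipschitzOnWith {f : ℝ → E3} {K : NNReal} {L : ℝ} (hL : 0 ≤ L)
    (hf : LipschitzOnWith K f (Icc 0 L)) (hm : MapsTo f (Icc 0 L) A) :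
    intrinsicEDist A (f 0) (f L) ≤ K * ENNReal.ofReal L := by
  have m : MapsTo (fun t : ℝ => L * t) (Icc 0 1) (Icc 0 L) := fun t ht =>
    ⟨mul_nonneg hL ht.1, mul_le_of_le_one_right hL ht.2⟩
  have h := intrinsicEDist_le_eVariationOn (A := A) (γ := fun t => f (L * t))
    (hf.continuousOn.comp (by fun_prop) m) (hm.comp m)
  simp only [mul_zero, mul_one] at h
  refine h.trans ?_
  refine (hf.comp_eVariationOn_le (g := fun t : ℝ => L * t) m).trans ?_
  gcongr
  have : MonotoneOn (fun t : ℝ => L * t) (Icc 0 1) := fun a _ b _ h =>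
    mul_le_mul_of_nonneg_left h hL
  have h2 := le_of_eq <| this.eVariationOn_eq (a := 0) (b := 1) (by simp) (by simp)
  simpa using h2

theorem intrinsicEDist_map_le (g : E3 ≃ₗᵢ[ℝ] E3) (hg : MapsTo g A A) :
    intrinsicEDist A (g p) (g q) ≤ intrinsicEDist A p q := by
  refine le_iInf₂ fun γ hγ => ?_
  obtain ⟨hc, hm, rfl, rfl⟩ := hγ
  refine (intrinsicEDist_le_eVariationOn (A := A) (γ := fun t => g (γ t))
    (g.continuous.comp_continuousOn hc) (hg.comp hm)).trans ?_
  have := (g.lipschitz.lipschitzOnWith (s := univ)).comp_eVariationOn_le (g := γ)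
    (mapsTo_univ _ (Icc (0 : ℝ) 1))
  simp only [ENNReal.coe_one, one_mul] at this
  exact this

end Intrinsic

end FlipGraph

/-! ### Angles, lengths of curves outside the ball, great circles -/

namespace FlipGraph

open InnerProductGeometry

section Angle

variable {V : Type*} [NormedAddCommGroup V] [InnerProductSpace ℝ V]

theorem norm_sub_of_norm_eq_one {x y : V} (hx : ‖x‖ = 1) (hy : ‖y‖ = 1) :
    ‖x - y‖ = 2 * Real.sin (angle x y / 2) := by
  have h0 := angle_nonneg x y
  have h1 := angle_le_pi x y
  have hs : 0 ≤ Real.sin (angle x y / 2) :=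
    Real.sin_nonneg_of_nonneg_of_le_pi (by linarith) (by linarith [Real.pi_pos])
  rw [← sq_eq_sq₀ (norm_nonneg _) (by positivity), norm_sub_sq_real, hx, hy]
  have h2 := inner_eq_cos_angle_of_norm_eq_one hx hy
  have h3 : Real.cos (angle x y) = 1 - 2 * Real.sin (angle x y / 2) ^ 2 := by
    conv_lhs => rw [show angle x y = 2 * (angle x y / 2) by ring]
    rw [Real.cos_two_mul, Real.cos_sq']
    ring
  rw [h2, h3]
  ring

theorem norm_sub_le_angle {x y : V} (hx : ‖x‖ = 1) (hy : ‖y‖ = 1) : ‖x - y‖ ≤ angle x y := by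
  rw [norm_sub_of_norm_eq_one hx hy]
  have := Real.sin_le (x := angle x y / 2) (by linarith [angle_nonneg x y])
  linarith

theorem angle_le_norm_sub {x y : V} (hx : ‖x‖ = 1) (hy : ‖y‖ = 1) :
    angle x y ≤ Real.pi / 2 * ‖x - y‖ := by
  rw [norm_sub_of_norm_eq_one hx hy]
  have := Real.mul_le_sin (x := angle x y / 2) (by linarith [angle_nonneg x y])
    (by linarith [angle_le_pi x y])
  have hp := Real.pi_pos
  have h2 : 2 / Real.pi * (angle x y / 2) * Real.pi ≤ Real.sin (angle x y / 2) * Real.pi := by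
    gcongr
  have h3 : 2 / Real.pi * (angle x y / 2) * Real.pi = angle x y := by field_simp
  linarith

/-- Chord and angle agree to first order: `θ / 2 ≤ tan (θ / 2)`, and `cos (θ / 2) > κ⁻¹` for small
`θ`. The two bounds on the chord secure the cosine estimate and the range of the tangent inequality.
-/
theorem exists_angle_le_mul_norm_sub {κ : ℝ} (hκ : 1 < κ) :
    ∃ δ > 0, ∀ x y : V, ‖x‖ = 1 → ‖y‖ = 1 → ‖x - y‖ < δ → angle x y ≤ κ * ‖x - y‖ := by
  have hc : ∀ᶠ θ in 𝓝 (0 : ℝ), κ⁻¹ < Real.cos (θ / 2) := by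
    have : Filter.Tendsto (fun θ : ℝ => Real.cos (θ / 2)) (𝓝 0) (𝓝 1) := by
      have h : Continuous fun θ : ℝ => Real.cos (θ / 2) := by fun_prop
      simpa using h.tendsto 0
    exact this.eventually_const_lt (inv_lt_one_of_one_lt₀ hκ)
  obtain ⟨η, hη, h⟩ := Metric.eventually_nhds_iff.1 hc
  have hp := Real.pi_pos
  refine ⟨min (η * (2 / Real.pi)) (2 / Real.pi), by positivity, fun x y hx hy hxy => ?_⟩
  have h1 := angle_le_norm_sub hx hy
  have h0 := angle_nonneg x y
  have h2 : angle x y < η := by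
    have : Real.pi / 2 * ‖x - y‖ < Real.pi / 2 * (η * (2 / Real.pi)) := by
      gcongr; exact hxy.trans_le (min_le_left _ _)
    have e : Real.pi / 2 * (η * (2 / Real.pi)) = η := by field_simp
    linarith
  have h3 : angle x y < 1 := by
    have : Real.pi / 2 * ‖x - y‖ < Real.pi / 2 * (2 / Real.pi) := by
      gcongr; exact hxy.trans_le (min_le_right _ _)
    have e : Real.pi / 2 * (2 / Real.pi) = 1 := by field_simp
    linarith
  have h4 := h (y := angle x y) (by rw [Real.dist_eq, sub_zero, abs_of_nonneg h0]; exact h2)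
  have hcpos : 0 < Real.cos (angle x y / 2) := (by positivity : (0 : ℝ) < κ⁻¹).trans h4
  have h5 := Real.le_tan (x := angle x y / 2) (by linarith)
    (by linarith [Real.pi_gt_three])
  rw [Real.tan_eq_sin_div_cos, le_div_iff₀ hcpos] at h5
  rw [norm_sub_of_norm_eq_one hx hy]
  have h6 : angle x y / 2 * κ⁻¹ ≤ Real.sin (angle x y / 2) :=
    (mul_le_mul_of_nonneg_left h4.le (by linarith)).trans h5
  have h7 : κ * (angle x y / 2 * κ⁻¹) ≤ κ * Real.sin (angle x y / 2) := by gcongr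
  have e : κ * (angle x y / 2 * κ⁻¹) = angle x y / 2 := by field_simp
  linarith

/-- Radial projection onto the sphere is 1-Lipschitz outside the open unit ball; this is why raising
the sphere shortens nothing. -/
theorem norm_normalize_sub_le {x y : V} (hx : 1 ≤ ‖x‖) (hy : 1 ≤ ‖y‖) :
    ‖‖x‖⁻¹ • x - ‖y‖⁻¹ • y‖ ≤ ‖x - y‖ := by
  rw [← sq_le_sq₀ (norm_nonneg _) (norm_nonneg _), norm_sub_sq_real, norm_sub_sq_real,
    norm_smul, norm_smul, real_inner_smul_left, real_inner_smul_right, norm_inv, norm_inv,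
    norm_norm, norm_norm, inv_mul_cancel₀ (by positivity), inv_mul_cancel₀ (by positivity)]
  have hc : inner ℝ x y ≤ ‖x‖ * ‖y‖ := real_inner_le_norm x y
  set a := ‖x‖
  set b := ‖y‖
  set c : ℝ := inner ℝ x y
  have hab : 1 ≤ a * b := one_le_mul_of_one_le_of_one_le hx hy
  have e : a⁻¹ * (b⁻¹ * c) = c / (a * b) := by field_simp
  rw [e]
  have h1 : c / (a * b) ≤ 1 := (div_le_one (by positivity)).2 hc
  have h2 : c = c / (a * b) * (a * b) := by field_simp
  -- With `q = c / (a * b)`, the difference of the two sides is `(a - b)² + 2 (a b - 1)(1 - q)`.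
  nlinarith [sq_nonneg (a - b), mul_nonneg (sub_nonneg.2 h1) (sub_nonneg.2 hab)]

theorem angle_zero_nat_le_sum {f : ℕ → V} (hf : ∀ i, f i ≠ 0) (n : ℕ) :
    angle (f 0) (f n) ≤ ∑ i ∈ Finset.range n, angle (f i) (f (i + 1)) := by
  induction n with
  | zero => simp [angle_self (hf 0)]
  | succ n ih =>
    rw [Finset.sum_range_succ]
    exact (angle_le_angle_add_angle _ (f n) _).trans (by gcongr)

/-- A curve outside the open unit ball is at least as long as the angle between its ends. -/
theorem angle_le_eVariationOn {γ : ℝ → V} (hc : ContinuousOn γ (Icc 0 1))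
    (h1 : ∀ t ∈ Icc (0 : ℝ) 1, 1 ≤ ‖γ t‖) :
    ENNReal.ofReal (angle (γ 0) (γ 1)) ≤ eVariationOn γ (Icc 0 1) := by
  by_cases htop : eVariationOn γ (Icc 0 1) = ⊤
  · simp [htop]
  set L := (eVariationOn γ (Icc 0 1)).toReal with hL
  -- Cut the curve so finely that each projected chord is nearly its angle, up to the factor `κ`; at
  -- the end `κ` tends to `1`.
  have key : ∀ κ : ℝ, 1 < κ → angle (γ 0) (γ 1) ≤ κ * L := by
    intro κ hκ
    obtain ⟨δ, hδ, hd⟩ := exists_angle_le_mul_norm_sub (V := V) hκ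
    have huc := isCompact_Icc.uniformContinuousOn_of_continuous hc
    rw [Metric.uniformContinuousOn_iff] at huc
    obtain ⟨η, hη, hu⟩ := huc δ hδ
    obtain ⟨N, hN⟩ := exists_nat_one_div_lt hη
    -- The truncation at `1` makes the equidistant partition a monotone sequence on all of `ℕ`
    -- inside `[0, 1]`.
    set u : ℕ → ℝ := fun i => min ((i : ℝ) / ((N : ℝ) + 1)) 1 with hu'
    have hpos : (0 : ℝ) < (N : ℝ) + 1 := by positivity
    have umem : ∀ i, u i ∈ Icc (0 : ℝ) 1 := fun i =>
      ⟨le_min (by positivity) zero_le_one, min_le_right _ _⟩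
    have umono : Monotone u := fun i j hij => by
      simp only [hu']
      gcongr
    have u0 : u 0 = 0 := by simp [hu']
    have u1 : u (N + 1) = 1 := by simp [hu', div_self hpos.ne']
    have ustep : ∀ i, dist (u i) (u (i + 1)) < η := fun i => by
      rw [dist_comm, Real.dist_eq, abs_of_nonneg (sub_nonneg.2 (umono (Nat.le_succ i)))]
      refine lt_of_le_of_lt ?_ hN
      have e : ((i + 1 : ℕ) : ℝ) / ((N : ℝ) + 1) = (i : ℝ) / ((N : ℝ) + 1) + 1 / ((N : ℝ) + 1) := by
        push_cast; ring
      simp only [hu', e]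
      have : (0 : ℝ) < 1 / ((N : ℝ) + 1) := by positivity
      rcases le_total ((i : ℝ) / ((N : ℝ) + 1)) 1 with h | h
      · rw [min_eq_left h]
        linarith [min_le_left ((i : ℝ) / ((N : ℝ) + 1) + 1 / ((N : ℝ) + 1)) 1]
      · rw [min_eq_right h]
        linarith [min_le_right ((i : ℝ) / ((N : ℝ) + 1) + 1 / ((N : ℝ) + 1)) 1]
    have gn : ∀ i, γ (u i) ≠ 0 := fun i h => by
      have := h1 _ (umem i)
      rw [h, norm_zero] at this
      linarith
    have hstep : ∀ i, angle (γ (u i)) (γ (u (i + 1))) ≤ κ * dist (γ (u (i + 1))) (γ (u i)) := by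
      intro i
      have hx := h1 _ (umem i)
      have hy := h1 _ (umem (i + 1))
      have hn := norm_normalize_sub_le hx hy
      have hlt : ‖γ (u i) - γ (u (i + 1))‖ < δ := by
        rw [← dist_eq_norm]; exact hu _ (umem i) _ (umem (i + 1)) (ustep i)
      have := hd (‖γ (u i)‖⁻¹ • γ (u i)) (‖γ (u (i + 1))‖⁻¹ • γ (u (i + 1)))
        (norm_smul_inv_norm (𝕜 := ℝ) (gn _)) (norm_smul_inv_norm (𝕜 := ℝ) (gn _))
        (hn.trans_lt hlt)
      rw [angle_smul_left_of_pos _ _ (by positivity), angle_smul_right_of_pos _ _ (by positivity)]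
        at this
      refine this.trans ?_
      rw [dist_comm, dist_eq_norm]
      gcongr
    have hsum := eVariationOn.sum_le (f := γ) (n := N + 1) umono umem
    have hsum' : ∑ i ∈ Finset.range (N + 1), dist (γ (u (i + 1))) (γ (u i)) ≤ L := by
      rw [hL, ← ENNReal.ofReal_le_iff_le_toReal htop,
        ENNReal.ofReal_sum_of_nonneg (fun _ _ => dist_nonneg)]
      simpa only [edist_dist] using hsum
    have h3 := angle_zero_nat_le_sum (f := fun i => γ (u i)) gn (N + 1)
    simp only [u0, u1] at h3
    calc angle (γ 0) (γ 1) ≤ ∑ i ∈ Finset.range (N + 1), angle (γ (u i)) (γ (u (i + 1))) := h3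
      _ ≤ ∑ i ∈ Finset.range (N + 1), κ * dist (γ (u (i + 1))) (γ (u i)) :=
          Finset.sum_le_sum fun i _ => hstep i
      _ = κ * ∑ i ∈ Finset.range (N + 1), dist (γ (u (i + 1))) (γ (u i)) := by
          rw [Finset.mul_sum]
      _ ≤ κ * L := by gcongr
  have hfin : angle (γ 0) (γ 1) ≤ L := by
    refine ge_of_tendsto (x := 𝓝[>] (1 : ℝ)) (f := fun κ : ℝ => κ * L) ?_ ?_
    · have h : Continuous fun κ : ℝ => κ * L := by fun_prop
      have := (h.tendsto 1).mono_left (nhdsWithin_le_nhds (s := Ioi 1))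
      simpa using this
    · filter_upwards [self_mem_nhdsWithin] with κ hκ using key κ hκ
  rw [← ENNReal.ofReal_toReal htop]
  exact ENNReal.ofReal_le_ofReal hfin

/-- The point at distance `t` from `x` on the great circle through `x` with unit tangent `w`. -/
noncomputable def circlePoint (x w : V) (t : ℝ) : V := Real.cos t • x + Real.sin t • w

variable {x y z w : V}

theorem inner_circlePoint (hx : ‖x‖ = 1) (hw : ‖w‖ = 1) (hxw : inner ℝ x w = 0) (s t : ℝ) :
    inner ℝ (circlePoint x w s) (circlePoint x w t) = Real.cos (s - t) := by
  have hwx : inner ℝ w x = 0 := by rw [real_inner_comm, hxw]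
  have hxx : inner ℝ x x = 1 := by rw [real_inner_self_eq_norm_sq, hx, one_pow]
  have hww : inner ℝ w w = 1 := by rw [real_inner_self_eq_norm_sq, hw, one_pow]
  simp only [circlePoint, inner_add_left, inner_add_right, real_inner_smul_left,
    real_inner_smul_right, hxx, hww, hxw, hwx, Real.cos_sub]
  ring

theorem norm_circlePoint (hx : ‖x‖ = 1) (hw : ‖w‖ = 1) (hxw : inner ℝ x w = 0) (t : ℝ) :
    ‖circlePoint x w t‖ = 1 := by
  have := inner_circlePoint hx hw hxw t t
  rw [real_inner_self_eq_norm_sq, sub_self, Real.cos_zero] at this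
  exact (pow_eq_one_iff_of_nonneg (norm_nonneg _) two_ne_zero).1 this

theorem angle_circlePoint (hx : ‖x‖ = 1) (hw : ‖w‖ = 1) (hxw : inner ℝ x w = 0) {s t : ℝ}
    (h : |s - t| ≤ Real.pi) : angle (circlePoint x w s) (circlePoint x w t) = |s - t| := by
  rw [angle, norm_circlePoint hx hw hxw, norm_circlePoint hx hw hxw, mul_one, div_one,
    inner_circlePoint hx hw hxw, ← Real.cos_abs, Real.arccos_cos (abs_nonneg _) h]

theorem lipschitzWith_circlePoint (hx : ‖x‖ = 1) (hw : ‖w‖ = 1) (hxw : inner ℝ x w = 0) :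
    LipschitzWith 1 (circlePoint x w) := by
  refine LipschitzWith.of_dist_le_mul fun s t => ?_
  rw [NNReal.coe_one, one_mul, dist_eq_norm, Real.dist_eq]
  rw [← sq_le_sq₀ (norm_nonneg _) (abs_nonneg _), norm_sub_sq_real, norm_circlePoint hx hw hxw,
    norm_circlePoint hx hw hxw, inner_circlePoint hx hw hxw, sq_abs]
  have := Real.one_sub_sq_div_two_le_cos (x := s - t)
  linarith

theorem exists_unit_tangent [FiniteDimensional ℝ V] (hd : 1 < Module.finrank ℝ V)
    (hx : ‖x‖ = 1) (hy : ‖y‖ = 1) :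
    ∃ w : V, ‖w‖ = 1 ∧ inner ℝ x w = 0 ∧ y = circlePoint x w (angle x y) := by
  have hcos := inner_eq_cos_angle_of_norm_eq_one hx hy
  have hxx : inner ℝ x x = 1 := by rw [real_inner_self_eq_norm_sq, hx, one_pow]
  set θ := angle x y with hθ
  have hort : inner ℝ x (y - Real.cos θ • x) = 0 := by
    rw [inner_sub_right, real_inner_smul_right, hxx, hcos]; ring
  have hnorm : ‖y - Real.cos θ • x‖ ^ 2 = Real.sin θ ^ 2 := by
    rw [norm_sub_sq_real, real_inner_smul_right, real_inner_comm, hcos, norm_smul, hx, hy,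
      Real.sin_sq, Real.norm_eq_abs, mul_one, sq_abs]
    ring
  have hs0 : 0 ≤ Real.sin θ := sin_angle_nonneg x y
  have hnorm' : ‖y - Real.cos θ • x‖ = Real.sin θ := by
    rwa [sq_eq_sq₀ (norm_nonneg _) hs0] at hnorm
  rcases hs0.eq_or_lt with h | h
  -- Here `y` is a multiple of `x`, and any unit vector orthogonal to `x` serves; this is where the
  -- dimension enters.
  · rw [← h, norm_eq_zero, sub_eq_zero] at hnorm'
    have hx0 : x ≠ 0 := fun h => by simp [h] at hx
    have hne : (ℝ ∙ x)ᗮ ≠ ⊥ := by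
      intro hb
      have h1 := Submodule.finrank_add_finrank_orthogonal (ℝ ∙ x)
      rw [hb, finrank_bot, finrank_span_singleton hx0] at h1
      omega
    obtain ⟨w, hw, hw0⟩ := Submodule.exists_mem_ne_zero_of_ne_bot hne
    rw [Submodule.mem_orthogonal_singleton_iff_inner_right] at hw
    refine ⟨‖w‖⁻¹ • w, norm_smul_inv_norm (𝕜 := ℝ) hw0, ?_, ?_⟩
    · rw [real_inner_smul_right, hw, mul_zero]
    · rw [circlePoint, ← h, zero_smul, add_zero]; exact hnorm'
  · refine ⟨(Real.sin θ)⁻¹ • (y - Real.cos θ • x), ?_, ?_, ?_⟩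
    · rw [norm_smul, hnorm', norm_inv, Real.norm_eq_abs, abs_of_pos h, inv_mul_cancel₀ h.ne']
    · rw [real_inner_smul_right, hort, mul_zero]
    · rw [circlePoint, smul_smul, mul_inv_cancel₀ h.ne', one_smul]; abel

/-- Equality in the spherical triangle inequality. -/
theorem eq_circlePoint_of_angle_add_angle (hx : ‖x‖ = 1) (hw : ‖w‖ = 1) (hxw : inner ℝ x w = 0)
    (hz : ‖z‖ = 1) {θ : ℝ} (hθ : θ < Real.pi)
    (h : angle x z + angle z (circlePoint x w θ) = θ) : z = circlePoint x w (angle x z) := by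
  set α := angle x z with hα
  set y := circlePoint x w θ with hy
  have hα0 : 0 ≤ α := angle_nonneg _ _
  have hβ0 : 0 ≤ angle z y := angle_nonneg _ _
  have hcx : inner ℝ z x = Real.cos α := by
    rw [real_inner_comm, inner_eq_cos_angle_of_norm_eq_one hx hz]
  have hcy : inner ℝ z y = Real.cos (θ - α) := by
    rw [inner_eq_cos_angle_of_norm_eq_one hz (norm_circlePoint hx hw hxw θ)]
    congr 1; linarith
  have hzy : inner ℝ z y = Real.cos θ * Real.cos α + Real.sin θ * inner ℝ z w := by
    rw [hy, circlePoint, inner_add_right, real_inner_smul_right, real_inner_smul_right, hcx]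
  -- Unit vectors with inner product `1` coincide. The products of `z` with `x` and `y` are known,
  -- and dividing by `sin θ` gives the product with `w`.
  have hone : inner ℝ z (circlePoint x w α) = 1 := by
    rw [circlePoint, inner_add_right, real_inner_smul_right, real_inner_smul_right, hcx]
    rcases (show 0 ≤ θ by linarith).eq_or_lt with h0 | h0
    · have : α = 0 := by linarith
      simp [this]
    · have hs := Real.sin_pos_of_pos_of_lt_pi h0 hθ
      have : inner ℝ z w = Real.sin α := by
        rw [hcy, Real.cos_sub] at hzy
        exact (mul_left_cancel₀ hs.ne' (by linarith)).symm
      rw [this, ← sq, ← sq, Real.cos_sq_add_sin_sq]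
  exact (inner_eq_one_iff_of_norm_eq_one hz (norm_circlePoint hx hw hxw α)).1 hone

/-- Between `x` and a point of the great circle at distance less than `π`, the points of the great
circle are the unit vectors in the cone spanned by these two points. -/
theorem circlePoint_mem_cone {θ t : ℝ} (h0 : 0 ≤ t) (h1 : t ≤ θ)
    (hθ : θ < Real.pi) :
    ∃ r s : ℝ, 0 ≤ r ∧ 0 ≤ s ∧ circlePoint x w t = r • x + s • circlePoint x w θ := by
  rcases (h0.trans h1).eq_or_lt with h | h
  · have : t = 0 := by linarith
    exact ⟨1, 0, by simp, by simp, by simp [circlePoint, this]⟩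
  · have hs := Real.sin_pos_of_pos_of_lt_pi h hθ
    refine ⟨Real.sin (θ - t) / Real.sin θ, Real.sin t / Real.sin θ, ?_, ?_, ?_⟩
    · exact div_nonneg (Real.sin_nonneg_of_nonneg_of_le_pi (by linarith) (by linarith)) hs.le
    · exact div_nonneg (Real.sin_nonneg_of_nonneg_of_le_pi (by linarith) (by linarith)) hs.le
    · rw [circlePoint, circlePoint, smul_add, smul_smul, smul_smul, ← add_assoc, ← add_smul,
        div_mul_cancel₀ _ hs.ne']
      congr 2
      rw [Real.sin_sub]; field_simp; ring

theorem mem_circlePoint_image_of_mem_cone (hx : ‖x‖ = 1) (hw : ‖w‖ = 1) (hxw : inner ℝ x w = 0)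
    {θ : ℝ} (h0 : 0 ≤ θ) (hθ : θ < Real.pi) (hz : ‖z‖ = 1) {r s : ℝ} (hr : 0 ≤ r) (hs : 0 ≤ s)
    (h : z = r • x + s • circlePoint x w θ) : z ∈ circlePoint x w '' Icc 0 θ := by
  have hsin : 0 ≤ Real.sin θ := Real.sin_nonneg_of_nonneg_of_le_pi h0 hθ.le
  set p := r + s * Real.cos θ with hp
  set q := s * Real.sin θ with hq
  have hz' : z = p • x + q • w := by
    rw [h, circlePoint, hp, hq]; module
  have hq0 : 0 ≤ q := mul_nonneg hs hsin
  have hpq : p ^ 2 + q ^ 2 = 1 := by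
    have : inner ℝ z z = p ^ 2 + q ^ 2 := by
      have hwx : inner ℝ w x = 0 := by rw [real_inner_comm, hxw]
      have hxx : inner ℝ x x = 1 := by rw [real_inner_self_eq_norm_sq, hx, one_pow]
      have hww : inner ℝ w w = 1 := by rw [real_inner_self_eq_norm_sq, hw, one_pow]
      rw [hz']
      simp only [inner_add_left, inner_add_right, real_inner_smul_left,
        real_inner_smul_right, hxx, hww, hxw, hwx]
      ring
    rw [← this, real_inner_self_eq_norm_sq, hz, one_pow]
  have hp1 : -1 ≤ p := by nlinarith
  have hp2 : p ≤ 1 := by nlinarith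
  have hsq : q = Real.sin (Real.arccos p) := by
    rw [Real.sin_arccos, eq_comm, Real.sqrt_eq_iff_mul_self_eq] <;> nlinarith
  refine ⟨Real.arccos p, ⟨Real.arccos_nonneg p, ?_⟩, ?_⟩
  -- Past `θ` the sine of the difference would be positive, but it equals `-(r sin θ) ≤ 0`. The
  -- difference is less than `π` unless `θ = 0` and `arccos p = π`; then `p = -1`, whereas `p = r +
  -- s ≥ 0`.
  · by_contra hlt
    push Not at hlt
    have h1 : Real.sin (Real.arccos p - θ) = - (r * Real.sin θ) := by
      rw [Real.sin_sub, ← hsq, Real.cos_arccos hp1 hp2, hp, hq]; ring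
    have h2 : 0 < Real.sin (Real.arccos p - θ) :=
      Real.sin_pos_of_pos_of_lt_pi (by linarith) (by
        rcases h0.eq_or_lt with h | h
        · rcases (Real.arccos_le_pi p).eq_or_lt with h' | h'
          · exfalso
            have hcp := Real.cos_arccos hp1 hp2
            rw [h', Real.cos_pi] at hcp
            rw [← h, Real.cos_zero] at hp
            linarith
          · linarith
        · linarith [Real.arccos_le_pi p])
    nlinarith [mul_nonneg hr hsin]
  · rw [circlePoint, Real.cos_arccos hp1 hp2, ← hsq, hz']

end Angle

end FlipGraph

/-! ### The raised sphere as a metric space -/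

namespace FlipGraph

open InnerProductGeometry

/-- A smooth height function with values at least `1`. -/
structure Height where
  toFun : E3 → ℝ
  contDiff : ContDiff ℝ ∞ toFun
  one_le : ∀ x, 1 ≤ toFun x

/-- The unit sphere, to be equipped with the intrinsic metric of the raised sphere. -/
def Raised (_ : Height) : Type := S2

namespace Raised

variable {h : Height}

/-- The point of the unit sphere below a point of the raised sphere. -/
def base (x : Raised h) : S2 := x

/-- The point of the raised sphere above a point of the unit sphere. -/
def ofBase (x : S2) : Raised h := x

/-- The point of the raised sphere, as a point of 3-space. -/
def emb (x : Raised h) : E3 := raise h.toFun x.base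

theorem emb_mem (x : Raised h) : x.emb ∈ range (raise h.toFun) := ⟨_, rfl⟩

theorem norm_base (x : Raised h) : ‖(x.base : E3)‖ = 1 := norm_eq_of_mem_sphere x.base

theorem one_le_norm_of_mem_range {p : E3} (hp : p ∈ range (raise h.toFun)) : 1 ≤ ‖p‖ := by
  obtain ⟨x, rfl⟩ := hp
  rw [raise, norm_smul, norm_eq_of_mem_sphere, mul_one, Real.norm_eq_abs]
  exact (h.one_le _).trans (le_abs_self _)

theorem angle_emb (x y : Raised h) : angle x.emb y.emb = angle (x.base : E3) y.base := by
  have h1 : 0 < h.toFun x.base := zero_lt_one.trans_le (h.one_le _)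
  have h2 : 0 < h.toFun y.base := zero_lt_one.trans_le (h.one_le _)
  rw [emb, emb, raise, raise, angle_smul_left_of_pos _ _ h1, angle_smul_right_of_pos _ _ h2]

theorem ofReal_angle_le_intrinsicEDist (x y : Raised h) :
    ENNReal.ofReal (angle (x.base : E3) y.base) ≤
      intrinsicEDist (range (raise h.toFun)) x.emb y.emb := by
  rw [← angle_emb]
  refine le_iInf₂ fun γ hγ => ?_
  obtain ⟨hc, hm, h0, h1⟩ := hγ
  rw [← h0, ← h1]
  exact angle_le_eVariationOn hc fun t ht => one_le_norm_of_mem_range (hm ht)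

theorem one_lt_finrank : 1 < Module.finrank ℝ E3 := by simp

variable (h) in
-- The smooth map `x ↦ ρ(x) x` is Lipschitz on the compact convex unit ball, so it lifts great
-- circle arcs to curves of controlled length. This gives finiteness of the metric and continuity of
-- the lift.
theorem exists_intrinsicEDist_le : ∃ K : NNReal, ∀ x y : Raised h,
    intrinsicEDist (range (raise h.toFun)) x.emb y.emb ≤
      K * ENNReal.ofReal (angle (x.base : E3) y.base) := by
  have hF : ContDiff ℝ ∞ fun x : E3 => h.toFun x • x := h.contDiff.smul contDiff_id
  obtain ⟨K, hK⟩ := hF.contDiffOn.exists_lipschitzOnWith (s := Metric.closedBall (0 : E3) 1)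
    (by simp) (convex_closedBall _ _) (isCompact_closedBall _ _)
  refine ⟨K, fun x y => ?_⟩
  obtain ⟨w, hw, hxw, hy⟩ := exists_unit_tangent one_lt_finrank (norm_base x) (norm_base y)
  set θ := angle (x.base : E3) y.base
  have hn := norm_circlePoint (norm_base x) hw hxw
  have hl := (lipschitzWith_circlePoint (norm_base x) hw hxw).lipschitzOnWith (s := Icc 0 θ)
  have hl' := hK.comp hl (fun t _ => by simp [hn t])
  rw [mul_one] at hl'
  have := intrinsicEDist_le_of_lipschitzOnWith (A := range (raise h.toFun)) (angle_nonneg _ _) hl'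
    (fun t _ => ⟨⟨circlePoint (x.base : E3) w t, by simp [hn t]⟩, rfl⟩)
  simp only [Function.comp_apply] at this
  have e0 : circlePoint (x.base : E3) w 0 = x.base := by simp [circlePoint]
  rw [← hy, e0] at this
  exact this

theorem eq_of_angle_base_eq_zero {x y : Raised h} (hxy : angle (x.base : E3) y.base = 0) :
    x = y := by
  have := norm_sub_of_norm_eq_one (norm_base x) (norm_base y)
  rw [hxy, zero_div, Real.sin_zero, mul_zero, norm_eq_zero, sub_eq_zero] at this
  exact Subtype.ext this

/-- The intrinsic distance, with values in the extended nonnegative reals. -/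
noncomputable abbrev eMetricSpace (h : Height) : EMetricSpace (Raised h) where
  edist x y := intrinsicEDist (range (raise h.toFun)) x.emb y.emb
  edist_self x := intrinsicEDist_self x.emb_mem
  edist_comm _ _ := intrinsicEDist_comm
  edist_triangle _ _ _ := intrinsicEDist_triangle
  eq_of_edist_eq_zero {x y} hxy := by
    have h1 := ofReal_angle_le_intrinsicEDist x y
    have h2 : intrinsicEDist (range (raise h.toFun)) x.emb y.emb = 0 := hxy
    rw [h2, nonpos_iff_eq_zero, ENNReal.ofReal_eq_zero] at h1
    exact eq_of_angle_base_eq_zero (le_antisymm h1 (angle_nonneg _ _))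

noncomputable instance : MetricSpace (Raised h) :=
  letI := eMetricSpace h
  EMetricSpace.toMetricSpace fun x y => by
    obtain ⟨K, hK⟩ := exists_intrinsicEDist_le h
    exact ((hK x y).trans_lt (ENNReal.mul_lt_top ENNReal.coe_lt_top ENNReal.ofReal_lt_top)).ne

theorem edist_eq (x y : Raised h) :
    edist x y = intrinsicEDist (range (raise h.toFun)) x.emb y.emb := rfl

theorem angle_le_dist (x y : Raised h) : angle (x.base : E3) y.base ≤ dist x y := by
  have := ofReal_angle_le_intrinsicEDist x y
  rwa [← edist_eq, edist_dist, ENNReal.ofReal_le_ofReal_iff dist_nonneg] at this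

theorem dist_emb_le (x y : Raised h) : dist x.emb y.emb ≤ dist x y := by
  have := edist_le_intrinsicEDist (A := range (raise h.toFun)) (p := x.emb) (q := y.emb)
  rwa [← edist_eq, edist_dist, edist_dist, ENNReal.ofReal_le_ofReal_iff dist_nonneg] at this

variable (h) in
theorem exists_dist_le : ∃ K : NNReal, ∀ x y : Raised h,
    dist x y ≤ K * angle (x.base : E3) y.base := by
  obtain ⟨K, hK⟩ := exists_intrinsicEDist_le h
  refine ⟨K, fun x y => ?_⟩
  have := hK x y
  rwa [← edist_eq, edist_dist, ← ENNReal.ofReal_coe_nnreal, ← ENNReal.ofReal_mul K.coe_nonneg,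
    ENNReal.ofReal_le_ofReal_iff (mul_nonneg K.coe_nonneg (angle_nonneg _ _))] at this

/-- The raised sphere is homeomorphic to the sphere. -/
noncomputable def homeo (h : Height) : Raised h ≃ₜ S2 where
  toFun := base
  invFun := ofBase
  left_inv _ := rfl
  right_inv _ := rfl
  continuous_toFun := by
    refine LipschitzWith.continuous (K := 1) (LipschitzWith.of_dist_le_mul fun x y => ?_)
    rw [NNReal.coe_one, one_mul, Subtype.dist_eq, dist_eq_norm]
    exact (norm_sub_le_angle (norm_base x) (norm_base y)).trans (angle_le_dist x y)
  continuous_invFun := by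
    obtain ⟨K, hK⟩ := exists_dist_le h
    refine LipschitzWith.continuous (K := K * (Real.pi / 2).toNNReal)
      (LipschitzWith.of_dist_le_mul fun x y => (hK (ofBase x) (ofBase y)).trans ?_)
    rw [NNReal.coe_mul, Real.coe_toNNReal _ (by positivity), mul_assoc, Subtype.dist_eq,
      dist_eq_norm]
    refine mul_le_mul_of_nonneg_left ?_ K.coe_nonneg
    exact angle_le_norm_sub (norm_eq_of_mem_sphere x) (norm_eq_of_mem_sphere y)

theorem emb_eq_of_height_eq_one {x : Raised h} (hx : h.toFun x.base = 1) : x.emb = x.base := by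
  rw [emb, raise, hx, one_smul]

end Raised

/-- The points of the unit sphere in the cone spanned by `a` and `b`. -/
def arc (a b : E3) : Set S2 := {x | ∃ r s : ℝ, 0 ≤ r ∧ 0 ≤ s ∧ (x : E3) = r • a + s • b}

namespace Raised

variable {h : Height}

/-- Where the sphere is not raised, the short arcs of great circles are segments. -/
theorem isSegment_of_height_eq_one {x y : Raised h} (hπ : angle (x.base : E3) y.base < Real.pi)
    (h1 : ∀ z ∈ arc x.base y.base, h.toFun z = 1) :
    IsSegment x y (homeo h ⁻¹' arc x.base y.base) ∧ dist x y = angle (x.base : E3) y.base := by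
  obtain ⟨w, hw, hxw, hy⟩ := exists_unit_tangent one_lt_finrank (norm_base x) (norm_base y)
  set θ := angle (x.base : E3) y.base with hθ
  have hθ0 : 0 ≤ θ := angle_nonneg _ _
  have hn := norm_circlePoint (norm_base x) hw hxw
  set g : ℝ → Raised h := fun t =>
    (homeo h).symm ⟨circlePoint (x.base : E3) w t, by simp [hn t]⟩ with hg
  have gb : ∀ t, ((g t).base : E3) = circlePoint (x.base : E3) w t := fun t => rfl
  have garc : ∀ t ∈ Icc 0 θ, (g t).base ∈ arc x.base y.base := fun t ht => by
    obtain ⟨r, s, hr, hs, e⟩ := circlePoint_mem_cone (x := (x.base : E3)) (w := w) ht.1 ht.2 hπ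
    exact ⟨r, s, hr, hs, by rw [gb, e, ← hy]⟩
  have gemb : ∀ t ∈ Icc 0 θ, (g t).emb = circlePoint (x.base : E3) w t := fun t ht => by
    rw [emb_eq_of_height_eq_one (h1 _ (garc t ht)), gb]
  have g0 : g 0 = x := Subtype.ext (by
    change circlePoint (x.base : E3) w 0 = x.base
    simp [circlePoint])
  have gθ : g θ = y := Subtype.ext hy.symm
  -- The arc itself lies in the surface, as the height is `1` along it. The reverse inequality is
  -- `angle_le_dist`.
  have hle : ∀ s ∈ Icc 0 θ, ∀ t ∈ Icc 0 θ, s ≤ t → dist (g s) (g t) ≤ t - s := by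
    intro s hs t ht hst
    have hl : LipschitzOnWith 1 (fun u => circlePoint (x.base : E3) w (s + u)) (Icc 0 (t - s)) := by
      have := (lipschitzWith_circlePoint (norm_base x) hw hxw).comp
        (LipschitzWith.of_dist_le_mul (K := 1) (f := fun u : ℝ => s + u) (by simp))
      rw [mul_one] at this
      exact this.lipschitzOnWith
    have := intrinsicEDist_le_of_lipschitzOnWith (A := range (raise h.toFun)) (sub_nonneg.2 hst) hl
      (fun u hu => by
        have hm : s + u ∈ Icc 0 θ := ⟨by linarith [hs.1, hu.1], by linarith [hu.2, ht.2]⟩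
        rw [← gemb _ hm]; exact emb_mem _)
    simp only [add_zero, add_sub_cancel, ENNReal.coe_one, one_mul] at this
    rwa [← gemb s hs, ← gemb t ht, ← edist_eq, edist_dist,
      ENNReal.ofReal_le_ofReal_iff (sub_nonneg.2 hst)] at this
  have hd : ∀ s ∈ Icc 0 θ, ∀ t ∈ Icc 0 θ, dist (g s) (g t) = |s - t| := by
    intro s hs t ht
    refine le_antisymm ?_ ?_
    · rcases le_total s t with hst | hst
      · rw [abs_sub_comm, abs_of_nonneg (sub_nonneg.2 hst)]; exact hle s hs t ht hst
      · rw [abs_of_nonneg (sub_nonneg.2 hst), dist_comm]; exact hle t ht s hs hst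
    · refine le_trans (le_of_eq ?_) (angle_le_dist _ _)
      rw [gb, gb, angle_circlePoint (norm_base x) hw hxw]
      rw [abs_le]; constructor <;> linarith [hs.1, hs.2, ht.1, ht.2]
  have hdist : dist x y = θ := by
    have := hd 0 ⟨le_rfl, hθ0⟩ θ ⟨hθ0, le_rfl⟩
    rwa [g0, gθ, zero_sub, abs_neg, abs_of_nonneg hθ0] at this
  have himage : homeo h ⁻¹' arc x.base y.base = g '' Icc 0 θ := by
    refine Subset.antisymm ?_ ?_
    · rintro z ⟨r, s, hr, hs, e⟩
      rw [hy] at e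
      obtain ⟨t, ht, e'⟩ := mem_circlePoint_image_of_mem_cone (norm_base x) hw hxw hθ0 hπ
        (norm_base z) hr hs e
      exact ⟨t, ht, Subtype.ext e'⟩
    · rintro _ ⟨t, ht, rfl⟩
      exact garc t ht
  refine ⟨⟨⟨g, g0, by rw [hdist, gθ], ?_, by rw [hdist, himage]⟩, ?_⟩, hdist⟩
  · rw [hdist]; exact hd
  · rintro s' ⟨γ, γ0, γ1, hγ, rfl⟩
    rw [himage]
    rw [hdist] at γ1 hγ ⊢
    refine image_congr fun t ht => Subtype.ext ?_
    have d0 : dist x (γ t) = t := by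
      have := hγ 0 ⟨le_rfl, hθ0⟩ t ht
      rwa [γ0, zero_sub, abs_neg, abs_of_nonneg ht.1] at this
    have d1 : dist (γ t) y = θ - t := by
      have := hγ t ht θ ⟨hθ0, le_rfl⟩
      rwa [γ1, abs_sub_comm, abs_of_nonneg (sub_nonneg.2 ht.2)] at this
    -- The angles from `γ t` to the two ends are at most `t` and `θ - t`, and they sum to at least
    -- `θ`. So equality holds in the spherical triangle inequality, which pins `γ t` to the arc.
    have a0 := angle_le_dist x (γ t)
    have a1 := angle_le_dist (γ t) y
    have a2 := angle_le_angle_add_angle (x.base : E3) (γ t).base y.base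
    have key := eq_circlePoint_of_angle_add_angle (norm_base x) hw hxw (norm_base (γ t)) hπ
      (by rw [← hy]; linarith)
    have e : angle (x.base : E3) (γ t).base = t := by linarith
    rw [e] at key
    exact key

/-- A linear isometry that preserves the height induces an isometry of the raised sphere. -/
noncomputable def map (g : E3 ≃ₗᵢ[ℝ] E3) (x : Raised h) : Raised h :=
  (homeo h).symm ⟨g x.base, by simp⟩

theorem base_map (g : E3 ≃ₗᵢ[ℝ] E3) (x : Raised h) : ((map g x).base : E3) = g x.base := rfl

theorem emb_map {g : E3 ≃ₗᵢ[ℝ] E3} (hg : ∀ x, h.toFun (g x) = h.toFun x) (x : Raised h) :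
    (map g x).emb = g x.emb := by
  simp only [emb, raise, base_map, hg, map_smul]

theorem dist_map_le {g : E3 ≃ₗᵢ[ℝ] E3} (hg : ∀ x, h.toFun (g x) = h.toFun x) (x y : Raised h) :
    dist (map g x) (map g y) ≤ dist x y := by
  have hm : MapsTo g (range (raise h.toFun)) (range (raise h.toFun)) := by
    rintro _ ⟨z, rfl⟩
    exact ⟨(map (h := h) g z).base, emb_map hg z⟩
  have := intrinsicEDist_map_le (p := x.emb) (q := y.emb) g hm
  rwa [← emb_map hg, ← emb_map hg, ← edist_eq, ← edist_eq, edist_dist, edist_dist,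
    ENNReal.ofReal_le_ofReal_iff dist_nonneg] at this

theorem dist_map {g : E3 ≃ₗᵢ[ℝ] E3} (hg : ∀ x, h.toFun (g x) = h.toFun x) (x y : Raised h) :
    dist (map g x) (map g y) = dist x y := by
  refine le_antisymm (dist_map_le hg x y) ?_
  have hg' : ∀ x, h.toFun (g.symm x) = h.toFun x := fun x => by rw [← hg, g.apply_symm_apply]
  have := dist_map_le hg' (map g x) (map g y)
  have e : ∀ z : Raised h, map g.symm (map g z) = z := fun z => Subtype.ext (by
    change g.symm (g z.base) = z.base
    simp)
  rwa [e, e] at this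

end Raised

/-! ### Isometries and endpoints of segments -/

section Segments

variable {M : Type*} [MetricSpace M] {a b c d : M} {s : Set M}

theorem IsMinGeodesic.image {f : M → M} (hf : ∀ x y, dist (f x) (f y) = dist x y) (ha : f a = a)
    (hb : f b = b) (hs : IsMinGeodesic a b s) : IsMinGeodesic a b (f '' s) := by
  obtain ⟨γ, h0, h1, hγ, rfl⟩ := hs
  refine ⟨f ∘ γ, by simp [h0, ha], by simp [h1, hb], fun t ht u hu => ?_, ?_⟩
  · rw [Function.comp_apply, Function.comp_apply, hf, hγ t ht u hu]
  · rw [image_comp]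

/-- An isometry that fixes the endpoints of a segment fixes the segment pointwise. -/
theorem IsSegment.map_eq_self {f : M → M} (hf : ∀ x y, dist (f x) (f y) = dist x y) (ha : f a = a)
    (hb : f b = b) (hs : IsSegment a b s) {x : M} (hx : x ∈ s) : f x = x := by
  have himg := hs.2 _ (hs.1.image hf ha hb)
  obtain ⟨γ, h0, h1, hγ, rfl⟩ := hs.1
  obtain ⟨t, ht, rfl⟩ := hx
  -- By uniqueness the image stays on the segment, where a point is determined by its distance from
  -- `a`; that distance is preserved.
  have : f (γ t) ∈ γ '' Icc 0 (dist a b) := himg ▸ mem_image_of_mem f ⟨t, ht, rfl⟩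
  obtain ⟨u, hu, e⟩ := this
  have d1 : dist a (γ t) = t := by
    have := hγ 0 ⟨le_rfl, dist_nonneg⟩ t ht
    rwa [h0, zero_sub, abs_neg, abs_of_nonneg ht.1] at this
  have d2 : dist a (γ u) = u := by
    have := hγ 0 ⟨le_rfl, dist_nonneg⟩ u hu
    rwa [h0, zero_sub, abs_neg, abs_of_nonneg hu.1] at this
  have d3 : dist a (f (γ t)) = t := by
    conv_lhs => rw [← ha]
    rw [hf, d1]
  rw [← e] at d3 ⊢
  rw [show u = t by linarith]

theorem IsSegment.symm (hs : IsSegment a b s) : IsSegment b a s := by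
  have key : ∀ {a b : M} {s : Set M}, IsMinGeodesic a b s → IsMinGeodesic b a s := by
    rintro a b s ⟨γ, h0, h1, hγ, rfl⟩
    refine ⟨fun t => γ (dist a b - t), by simp [h1], by simp [dist_comm b a, h0], ?_, ?_⟩
    · rw [dist_comm b a]
      intro t ht u hu
      rw [hγ _ ⟨by linarith [ht.2], by linarith [ht.1]⟩ _ ⟨by linarith [hu.2], by linarith [hu.1]⟩,
        abs_sub_comm]
      congr 1; ring
    · rw [dist_comm b a]
      ext x
      constructor
      · rintro ⟨t, ht, rfl⟩
        exact ⟨dist a b - t, ⟨by linarith [ht.2], by linarith [ht.1]⟩, by simp⟩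
      · rintro ⟨t, ht, rfl⟩
        exact ⟨dist a b - t, ⟨by linarith [ht.2], by linarith [ht.1]⟩, rfl⟩
  exact ⟨key hs.1, fun s' h' => hs.2 s' (key h')⟩

theorem IsSegment.eq {t : Set M} (hs : IsSegment a b s) (ht : IsSegment a b t) : s = t :=
  ht.2 s hs.1

theorem IsMinGeodesic.left_mem (hs : IsMinGeodesic a b s) : a ∈ s := by
  obtain ⟨γ, h0, h1, hγ, rfl⟩ := hs
  exact ⟨0, ⟨le_rfl, dist_nonneg⟩, h0⟩

theorem IsMinGeodesic.right_mem (hs : IsMinGeodesic a b s) : b ∈ s := by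
  obtain ⟨γ, h0, h1, hγ, rfl⟩ := hs
  exact ⟨dist a b, ⟨dist_nonneg, le_rfl⟩, h1⟩

theorem IsMinGeodesic.dist_le (hs : IsMinGeodesic a b s) {x y : M} (hx : x ∈ s) (hy : y ∈ s) :
    dist x y ≤ dist a b := by
  obtain ⟨γ, h0, h1, hγ, rfl⟩ := hs
  obtain ⟨t, ht, rfl⟩ := hx
  obtain ⟨u, hu, rfl⟩ := hy
  rw [hγ t ht u hu, abs_le]
  constructor <;> linarith [ht.1, ht.2, hu.1, hu.2]

/-- A segment determines its endpoints. -/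
theorem IsMinGeodesic.endpoints (hs : IsMinGeodesic a b s) (hs' : IsMinGeodesic c d s) :
    (c = a ∧ d = b) ∨ (c = b ∧ d = a) := by
  -- Both numbers are the diameter of `s`, which only the two extreme parameters realise.
  have hd : dist c d = dist a b :=
    le_antisymm (hs.dist_le hs'.left_mem hs'.right_mem) (hs'.dist_le hs.left_mem hs.right_mem)
  have hc := hs'.left_mem
  have hd' := hs'.right_mem
  obtain ⟨γ, h0, h1, hγ, rfl⟩ := hs
  obtain ⟨t, ht, rfl⟩ := hc
  obtain ⟨u, hu, rfl⟩ := hd'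
  rw [hγ t ht u hu] at hd
  rcases abs_choice (t - u) with h | h <;> rw [h] at hd
  · right
    rw [show t = dist a b by linarith [ht.2, hu.1], show u = 0 by linarith [ht.2, hu.1]]
    exact ⟨h1, h0⟩
  · left
    rw [show u = dist a b by linarith [ht.1, hu.2], show t = 0 by linarith [ht.1, hu.2]]
    exact ⟨h0, h1⟩

end Segments

end FlipGraph

/-! ### Faces, frontiers and convex cells on the sphere -/

namespace FlipGraph

section Topology

variable {X : Type*} [TopologicalSpace X]

/-- A connected part of `F` cannot leave `O` when the frontier of `O` has been removed. This
identifies the faces with explicit open triangles. -/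
theorem connectedComponentIn_eq_of_frontier {F O : Set X} (hO : IsOpen O) (hc : IsPreconnected O)
    (hOF : O ⊆ F) (hf : ∀ y ∈ frontier O, y ∉ F) {x : X} (hx : x ∈ O) :
    connectedComponentIn F x = O := by
  refine Subset.antisymm ?_ (hc.subset_connectedComponentIn hx hOF)
  refine isPreconnected_connectedComponentIn.subset_of_closure_inter_subset hO
    ⟨x, mem_connectedComponentIn (hOF hx), hx⟩ ?_
  rintro y ⟨hy, hyC⟩
  by_contra hyO
  exact hf y (hO.frontier_eq ▸ ⟨hy, hyO⟩) (connectedComponentIn_subset _ _ hyC)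

/-- Applied to the arc from the centre to a vertex, which starts in the central face and ends
outside it. -/
theorem IsPreconnected.exists_mem_frontier {K C : Set X} (hK : IsPreconnected K) {x y : X}
    (hx : x ∈ K) (hxC : x ∈ C) (hy : y ∈ K) (hyC : y ∉ C) : ∃ z ∈ K, z ∈ frontier C := by
  by_contra! hcon
  have h1 : K ⊆ interior C := by
    refine hK.subset_of_closure_inter_subset isOpen_interior ?_ ?_
    · refine ⟨x, hx, ?_⟩
      by_contra h
      exact hcon x hx ⟨subset_closure hxC, h⟩
    · rintro z ⟨hz, hzK⟩
      by_contra h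
      exact hcon z hzK ⟨closure_mono interior_subset hz, h⟩
  exact hyC (interior_subset (h1 hy))

theorem IsDisc.preimage {M N : Type*} [MetricSpace M] [MetricSpace N] (Φ : M ≃ₜ N) {R : Set N}
    (hR : IsDisc R) : IsDisc (Φ ⁻¹' R) := by
  obtain ⟨e⟩ := hR
  refine ⟨(Φ.subtype (p := (· ∈ Φ ⁻¹' R)) (q := (· ∈ R)) fun _ => Iff.rfl).trans e⟩

end Topology

section Cell

variable {ι : Type*} {ℓ : ι → E3 →L[ℝ] ℝ} {x₀ : S2}

/-- The points of the sphere at which the given linear functionals are positive. -/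
def openCell {ι : Type*} (ℓ : ι → E3 →L[ℝ] ℝ) : Set S2 := {x | ∀ i, 0 < ℓ i x}

/-- The points of the sphere at which the given linear functionals are nonnegative. -/
def closedCell {ι : Type*} (ℓ : ι → E3 →L[ℝ] ℝ) : Set S2 := {x | ∀ i, 0 ≤ ℓ i x}

theorem openCell_subset_closedCell : openCell ℓ ⊆ closedCell ℓ := fun _ hx i => (hx i).le

theorem isOpen_openCell [Finite ι] : IsOpen (openCell ℓ) := by
  have : openCell ℓ = ⋂ i, {x : S2 | 0 < ℓ i x} := by ext; simp [openCell]
  rw [this]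
  exact isOpen_iInter_of_finite fun i => isOpen_lt continuous_const (by fun_prop)

theorem isClosed_closedCell : IsClosed (closedCell ℓ) := by
  have : closedCell ℓ = ⋂ i, {x : S2 | 0 ≤ ℓ i x} := by ext; simp [closedCell]
  rw [this]
  exact isClosed_iInter fun i => isClosed_le continuous_const (by fun_prop)

/-- The radial projection to the unit sphere. -/
noncomputable def toSphere (x : E3) (hx : x ≠ 0) : S2 :=
  ⟨‖x‖⁻¹ • x, by
    rw [mem_sphere_zero_iff_norm]; exact norm_smul_inv_norm (𝕜 := ℝ) hx⟩

theorem coe_ne_zero (x : S2) : (x : E3) ≠ 0 := fun h => by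
  have := norm_eq_of_mem_sphere x
  rw [h, norm_zero] at this
  exact zero_ne_one this

/-- Points near `x` on the half great circle towards `y`. -/
theorem mem_closure_of_add_smul {s : Set S2} {x : S2} {y : E3}
    (h : ∀ ε : ℝ, 0 < ε → ∃ hne : (x : E3) + ε • y ≠ 0, toSphere (x + ε • y) hne ∈ s) :
    x ∈ closure s := by
  rw [closure_subtype]
  refine mem_closure_of_tendsto (b := 𝓝[>] (0 : ℝ))
    (f := fun ε : ℝ => ‖(x : E3) + ε • y‖⁻¹ • ((x : E3) + ε • y)) ?_ ?_
  · have hc : ContinuousAt (fun ε : ℝ => ‖(x : E3) + ε • y‖⁻¹ • ((x : E3) + ε • y)) 0 := by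
      have hl : Continuous fun ε : ℝ => (x : E3) + ε • y := by fun_prop
      refine (hl.norm.continuousAt.inv₀ ?_).smul hl.continuousAt
      simp
    have := hc.tendsto.mono_left (nhdsWithin_le_nhds (s := Ioi 0))
    simpa using this
  · filter_upwards [self_mem_nhdsWithin] with ε hε
    obtain ⟨hne, hm⟩ := h ε hε
    exact ⟨_, hm, rfl⟩

theorem toSphere_mem_openCell {x : E3} (hx : x ≠ 0) :
    toSphere x hx ∈ openCell ℓ ↔ ∀ i, 0 < ℓ i x := by
  have : 0 < ‖x‖⁻¹ := by positivity
  simp [openCell, toSphere, this]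

theorem toSphere_mem_closedCell {x : E3} (hx : x ≠ 0) :
    toSphere x hx ∈ closedCell ℓ ↔ ∀ i, 0 ≤ ℓ i x := by
  have : 0 < ‖x‖⁻¹ := by positivity
  simp [closedCell, toSphere, this]

theorem ne_zero_of_apply_ne_zero {φ : E3 →L[ℝ] ℝ} {x : E3} (h : φ x ≠ 0) : x ≠ 0 := by
  rintro rfl; exact h (map_zero φ)

/-- Nudging a point of the closed cell towards `x₀` makes every functional positive. Since there is
some functional, the nudged vector is nonzero. -/
theorem closure_openCell [Nonempty ι] (h₀ : x₀ ∈ openCell ℓ) :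
    closure (openCell ℓ) = closedCell ℓ := by
  refine Subset.antisymm (closure_minimal openCell_subset_closedCell isClosed_closedCell) ?_
  intro x hx
  refine mem_closure_of_add_smul (y := x₀) fun ε hε => ?_
  have hpos : ∀ i, 0 < ℓ i ((x : E3) + ε • (x₀ : E3)) := fun i => by
    rw [map_add, map_smul]
    exact add_pos_of_nonneg_of_pos (hx i) (mul_pos hε (h₀ i))
  exact ⟨ne_zero_of_apply_ne_zero (hpos (Classical.arbitrary ι)).ne',
    (toSphere_mem_openCell _).2 hpos⟩

/-- Where a functional vanishes, nudging away from `x₀` makes it negative. -/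
theorem interior_closedCell [Finite ι] (h₀ : x₀ ∈ openCell ℓ) :
    interior (closedCell ℓ) = openCell ℓ := by
  refine Subset.antisymm ?_ (interior_maximal openCell_subset_closedCell isOpen_openCell)
  intro x hx
  by_contra hcon
  have hxc := interior_subset hx
  simp only [openCell, mem_ofPred_eq, not_forall, not_lt] at hcon
  obtain ⟨i, hi⟩ := hcon
  have hi0 : ℓ i x = 0 := le_antisymm hi (hxc i)
  refine (?_ : x ∉ interior (closedCell ℓ)) hx
  rw [← mem_compl_iff, ← closure_compl]
  refine mem_closure_of_add_smul (y := -(x₀ : E3)) fun ε hε => ?_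
  have hneg : ℓ i ((x : E3) + ε • (-(x₀ : E3))) < 0 := by
    rw [map_add, map_smul, hi0, map_neg, zero_add, smul_eq_mul, mul_neg]
    exact neg_neg_of_pos (mul_pos hε (h₀ i))
  refine ⟨ne_zero_of_apply_ne_zero hneg.ne, ?_⟩
  rw [mem_compl_iff, toSphere_mem_closedCell]
  exact fun h => absurd (h i) (not_le.2 hneg)

theorem frontier_openCell [Finite ι] [Nonempty ι] (h₀ : x₀ ∈ openCell ℓ) :
    frontier (openCell ℓ) = closedCell ℓ \ openCell ℓ := by
  rw [isOpen_openCell.frontier_eq, closure_openCell h₀]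

theorem frontier_closedCell [Finite ι] (h₀ : x₀ ∈ openCell ℓ) :
    frontier (closedCell ℓ) = closedCell ℓ \ openCell ℓ := by
  rw [isClosed_closedCell.frontier_eq, interior_closedCell h₀]

/-- The cell is the radial projection of an open convex cone that does not contain the origin. -/
theorem isPreconnected_openCell [Nonempty ι] : IsPreconnected (openCell ℓ) := by
  rw [← IsInducing.subtypeVal.isPreconnected_image]
  have hconv : Convex ℝ {x : E3 | ∀ i, 0 < ℓ i x} := by
    have : {x : E3 | ∀ i, 0 < ℓ i x} = ⋂ i, {x : E3 | 0 < ℓ i x} := by ext; simp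
    rw [this]
    exact convex_iInter fun i => convex_halfSpace_gt (ℓ i).isLinear 0
  have himg : Subtype.val '' openCell ℓ =
      (fun x : E3 => ‖x‖⁻¹ • x) '' {x : E3 | ∀ i, 0 < ℓ i x} := by
    ext y
    constructor
    · rintro ⟨x, hx, rfl⟩
      exact ⟨x, hx, by simp⟩
    · rintro ⟨x, hx, rfl⟩
      have hx0 : x ≠ 0 := ne_zero_of_apply_ne_zero (hx (Classical.arbitrary ι)).ne'
      exact ⟨_, (toSphere_mem_openCell hx0).2 hx, rfl⟩
  rw [himg]
  refine hconv.isPreconnected.image _ fun x hx => ?_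
  have hx0 : x ≠ 0 := ne_zero_of_apply_ne_zero (hx (Classical.arbitrary ι)).ne'
  exact (ContinuousAt.smul (ContinuousAt.inv₀ (by fun_prop) (norm_ne_zero_iff.2 hx0))
    (by fun_prop)).continuousWithinAt

theorem isDisc_of_convex {K : Set (EuclideanSpace ℝ (Fin 2))} (hK : IsCompact K)
    (hc : Convex ℝ K) (hi : (interior K).Nonempty) : IsDisc K := by
  obtain ⟨e, -, he, -⟩ := exists_homeomorph_image_interior_closure_frontier_eq_unitBall hc hi
    hK.isBounded
  rw [hK.isClosed.closure_eq] at he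
  exact ⟨(e.image K).trans (Homeomorph.setCongr he)⟩

/-- A cell that contains no line is a disc. -/
theorem isDisc_closedCell [Finite ι] [Nonempty ι] (h₀ : x₀ ∈ openCell ℓ)
    (hℓ : ∀ x : E3, (∀ i, ℓ i x = 0) → x = 0) : IsDisc (closedCell ℓ) := by
  have := Fintype.ofFinite ι
  -- The sum of the functionals is positive on the closed cell, since no nonzero vector is killed by
  -- all of them. Central projection to the plane `φ = 1` then turns the cell into a compact convex
  -- planar set `K` with interior point `m`.
  set φ : E3 →L[ℝ] ℝ := ∑ i, ℓ i with hφ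
  have φapp : ∀ x, φ x = ∑ i, ℓ i x := fun x => by simp [hφ]
  have φpos : ∀ x ∈ closedCell ℓ, 0 < φ x := by
    intro x hx
    rw [φapp]
    refine (Finset.sum_nonneg fun i _ => hx i).lt_of_ne fun h => coe_ne_zero x (hℓ x fun i => ?_)
    exact (Finset.sum_eq_zero_iff_of_nonneg fun i _ => hx i).1 h.symm i (Finset.mem_univ _)
  have φ0 := φpos x₀ (openCell_subset_closedCell h₀)
  set m : E3 := (φ x₀)⁻¹ • (x₀ : E3) with hm
  have φm : φ m = 1 := by rw [hm, map_smul, smul_eq_mul, inv_mul_cancel₀ φ0.ne']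
  have hmpos : ∀ i, 0 < ℓ i m := fun i => by
    rw [hm, map_smul]; exact mul_pos (inv_pos.2 φ0) (h₀ i)
  have hker : Module.finrank ℝ φ.ker = 2 := by
    have h1 := φ.toLinearMap.finrank_range_add_finrank_ker
    have h2 : φ.toLinearMap.range = ⊤ := by
      rw [LinearMap.range_eq_top]
      intro r
      exact ⟨r • m, by simp [φm]⟩
    rw [h2, finrank_top, Module.finrank_self, finrank_euclideanSpace_fin] at h1
    have h3 : Module.finrank ℝ φ.toLinearMap.ker = 2 := by omega
    exact h3
  let j : EuclideanSpace ℝ (Fin 2) ≃ₗᵢ[ℝ] φ.ker :=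
    ((stdOrthonormalBasis ℝ φ.ker).reindex (finCongr hker)).repr.symm
  set K : Set (EuclideanSpace ℝ (Fin 2)) := {y | ∀ i, 0 ≤ ℓ i (m + (j y : E3))} with hK
  have φj : ∀ y, φ (m + (j y : E3)) = 1 := fun y => by
    have h0 : φ (j y : E3) = 0 := (j y).2
    rw [map_add, φm, h0, add_zero]
  have hne : ∀ y, m + (j y : E3) ≠ 0 := fun y => ne_zero_of_apply_ne_zero (φ := φ) (by simp [φj])
  have hinv : ∀ x ∈ closedCell ℓ, φ ((φ x)⁻¹ • (x : E3) - m) = 0 := fun x hx => by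
    rw [map_sub, φm, map_smul, smul_eq_mul, inv_mul_cancel₀ (φpos x hx).ne', sub_self]
  let e : K ≃ₜ closedCell ℓ :=
    { toFun := fun y => ⟨toSphere _ (hne y), (toSphere_mem_closedCell _).2 y.2⟩
      invFun := fun x => ⟨j.symm ⟨(φ x)⁻¹ • (x : E3) - m, hinv x x.2⟩, fun i => by
        have := mul_nonneg (inv_pos.2 (φpos x x.2)).le (x.2 i)
        simpa using this⟩
      left_inv := fun y => by
        apply Subtype.ext
        apply j.injective
        apply Subtype.ext
        have hn : ‖m + (j y : E3)‖ ≠ 0 := norm_ne_zero_iff.2 (hne y)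
        simp [toSphere, -smul_add, -map_add, φj, smul_smul, hn]
      right_inv := fun x => by
        apply Subtype.ext
        apply Subtype.ext
        have hp := φpos x x.2
        simp [toSphere, norm_smul, smul_smul, abs_of_pos hp, hp.ne']
      continuous_toFun := by
        refine Continuous.subtype_mk (Continuous.subtype_mk ?_ _) _
        have hj : Continuous fun y : K => (j y : E3) :=
          continuous_subtype_val.comp (j.continuous.comp continuous_subtype_val)
        exact ((continuous_const.add hj).norm.inv₀ fun y => norm_ne_zero_iff.2 (hne y)).smul
          (continuous_const.add hj)
      continuous_invFun := by
        refine Continuous.subtype_mk (j.symm.continuous.comp (Continuous.subtype_mk ?_ _)) _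
        have hc : Continuous fun x : closedCell ℓ => ((x : S2) : E3) :=
          continuous_subtype_val.comp continuous_subtype_val
        exact (((φ.continuous.comp hc).inv₀ fun x => (φpos x x.2).ne').smul hc).sub
          continuous_const }
  -- Compactness is inherited from the closed cell through the homeomorphism `e`.
  have hKc : IsCompact K := by
    rw [isCompact_iff_compactSpace]
    have : CompactSpace (closedCell ℓ) :=
      isCompact_iff_compactSpace.1 isClosed_closedCell.isCompact
    exact e.symm.compactSpace
  have hconv : Convex ℝ K := by
    intro y hy z hz a b ha hb hab i
    have e1 : m + (j (a • y + b • z) : E3) = a • (m + (j y : E3)) + b • (m + (j z : E3)) := by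
      have : m = (a + b) • m := by rw [hab, one_smul]
      conv_lhs => rw [this]
      simp only [map_add, map_smul, Submodule.coe_add, Submodule.coe_smul]
      module
    rw [e1, map_add, map_smul, map_smul]
    exact add_nonneg (mul_nonneg ha (hy i)) (mul_nonneg hb (hz i))
  have hint : (interior K).Nonempty := by
    refine ⟨0, mem_interior.2 ⟨{y | ∀ i, 0 < ℓ i (m + (j y : E3))},
      fun y hy i => (hy i).le, ?_, ?_⟩⟩
    · have : {y | ∀ i, 0 < ℓ i (m + (j y : E3))} = ⋂ i, {y | 0 < ℓ i (m + (j y : E3))} := by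
        ext; simp
      rw [this]
      have hj : Continuous fun y => (j y : E3) := continuous_subtype_val.comp j.continuous
      exact isOpen_iInter_of_finite fun i =>
        isOpen_lt continuous_const ((ℓ i).continuous.comp (continuous_const.add hj))
    · intro i
      simpa using hmpos i
  obtain ⟨d⟩ := isDisc_of_convex hKc hconv hint
  exact ⟨e.symm.trans d⟩

end Cell

end FlipGraph

/-! ### Linear coordinates adapted to the hexagon -/

namespace FlipGraph

section Coordinates

variable (B : OrthonormalBasis (Fin 3) ℝ E3)

/-- The height above the equator. -/
noncomputable def height : E3 →L[ℝ] ℝ := innerSL ℝ (B 2)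

/-- The vector that represents the `j`-th horizontal coordinate. -/
noncomputable def horizontalVec : Fin 6 → E3 :=
  ![(2 : ℝ) • B 0 - (2 : ℝ) • B 1, (2 : ℝ) • B 0, (2 : ℝ) • B 1, (2 : ℝ) • B 1 - (2 : ℝ) • B 0,
    (-2 : ℝ) • B 0, (-2 : ℝ) • B 1]

/-- Six horizontal coordinates; any two which are not opposite determine the others. -/
noncomputable def horizontal (j : Fin 6) : E3 →L[ℝ] ℝ := innerSL ℝ (horizontalVec B j)

/-- Vectors in the directions of the vertices of the hexagon. -/
noncomputable def vertexVec : Fin 6 → E3 :=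
  ![B 2 + (1 / 2 : ℝ) • B 0, B 2 + (1 / 2 : ℝ) • B 0 + (1 / 2 : ℝ) • B 1,
    B 2 + (1 / 2 : ℝ) • B 1, B 2 - (1 / 2 : ℝ) • B 0,
    B 2 - (1 / 2 : ℝ) • B 0 - (1 / 2 : ℝ) • B 1, B 2 - (1 / 2 : ℝ) • B 1]

/-- The relation is invariant under shifts of the index, so all six functionals are expressed
through those of index `i` and `i + 2` by formulas independent of `i`. -/
theorem horizontal_add_two (j : Fin 6) (x : E3) :
    horizontal B (j + 2) x = horizontal B (j + 1) x - horizontal B j x := by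
  fin_cases j <;>
    simp [horizontal, horizontalVec] <;> ring

/-- The values depend only on the offset `k`: the hexagon is affinely regular though not regular,
which keeps the arithmetic rational and the indices cyclic. -/
theorem horizontal_vertexVec (i k : Fin 6) :
    horizontal B (i + k) (vertexVec B i) = (![1, 1, 0, -1, -1, 0] : Fin 6 → ℝ) k := by
  fin_cases i <;> fin_cases k <;>
    simp [horizontal, horizontalVec, vertexVec, inner_add_right, inner_sub_right,
      real_inner_smul_right]

theorem height_vertexVec (i : Fin 6) : height B (vertexVec B i) = 1 := by
  fin_cases i <;>
    simp [height, vertexVec, inner_add_right, inner_sub_right, real_inner_smul_right]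

theorem horizontal_basis_two (j : Fin 6) : horizontal B j (B 2) = 0 := by
  fin_cases j <;>
    simp [horizontal, horizontalVec]

theorem height_basis_two : height B (B 2) = 1 := by simp [height]

variable {B}

theorem horizontal_add_three (j : Fin 6) (x : E3) :
    horizontal B (j + 3) x = - horizontal B j x := by
  have h1 := horizontal_add_two B j x
  have h2 := horizontal_add_two B (j + 1) x
  simp only [add_assoc, Fin.reduceAdd] at h1 h2
  linarith

theorem horizontal_add_one (j : Fin 6) (x : E3) :
    horizontal B (j + 1) x = horizontal B j x + horizontal B (j + 2) x := by
  rw [horizontal_add_two]; ring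

theorem horizontal_add_four (j : Fin 6) (x : E3) :
    horizontal B (j + 4) x = - horizontal B j x - horizontal B (j + 2) x := by
  have h1 := horizontal_add_three (j + 1) x (B := B)
  simp only [add_assoc, Fin.reduceAdd] at h1
  rw [h1, horizontal_add_one]; ring

theorem horizontal_add_five (j : Fin 6) (x : E3) :
    horizontal B (j + 5) x = - horizontal B (j + 2) x := by
  have h1 := horizontal_add_three (j + 2) x (B := B)
  simpa only [add_assoc, Fin.reduceAdd] using h1

theorem eq_zero_of_coordinates (i : Fin 6) {x : E3} (h1 : horizontal B i x = 0)
    (h2 : horizontal B (i + 2) x = 0) (h3 : height B x = 0) : x = 0 := by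
  have h0 : ∀ k : Fin 6, horizontal B (i + k) x = 0 := by
    intro k
    fin_cases k <;>
      simp [horizontal_add_one, horizontal_add_three, horizontal_add_four, horizontal_add_five,
        h1, h2]
  have h4 : horizontal B 1 x = 0 := by simpa using h0 (1 - i)
  have h5 : horizontal B 2 x = 0 := by simpa using h0 (2 - i)
  simp only [horizontal, horizontalVec, innerSL_apply_apply] at h4 h5
  simp [real_inner_smul_left] at h4 h5
  simp only [height, innerSL_apply_apply] at h3
  rw [← B.sum_repr x]
  simp [Fin.sum_univ_three, B.repr_apply_apply, h3, h4, h5]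

theorem eq_of_coordinates (i : Fin 6) {x y : E3} (h1 : horizontal B i x = horizontal B i y)
    (h2 : horizontal B (i + 2) x = horizontal B (i + 2) y) (h3 : height B x = height B y) :
    x = y := by
  rw [← sub_eq_zero]
  apply eq_zero_of_coordinates (B := B) i <;> simp [h1, h2, h3]

variable (B)

/-- Vectors in the directions of the vertices of the hexagon and of the pole below it. -/
noncomputable def nodeVec : Option (Fin 6) → E3
  | some i => vertexVec B i
  | none => -B 2

theorem nodeVec_ne_zero (m : Option (Fin 6)) : nodeVec B m ≠ 0 := by
  apply ne_zero_of_apply_ne_zero (φ := height B)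
  cases m <;> simp [nodeVec, height_vertexVec, height_basis_two]

/-- The vertices of the hexagon and the pole below it, on the unit sphere. -/
noncomputable def node (m : Option (Fin 6)) : S2 := toSphere (nodeVec B m) (nodeVec_ne_zero B m)

variable {B}

theorem eq_toSphere {x : S2} {p : E3} (hp : p ≠ 0) {r : ℝ} (hr : 0 ≤ r) (h : (x : E3) = r • p) :
    x = toSphere p hp := by
  have hn := norm_eq_of_mem_sphere x
  have hp' : ‖p‖ ≠ 0 := norm_ne_zero_iff.2 hp
  rw [h, norm_smul, Real.norm_eq_abs, abs_of_nonneg hr] at hn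
  have : r = ‖p‖⁻¹ := by field_simp; exact hn
  exact Subtype.ext (by rw [h, this]; rfl)

theorem eq_node_some {x : S2} (i : Fin 6) (h1 : horizontal B (i + 2) x = 0)
    (h2 : height B x = horizontal B i x) (h3 : 0 ≤ horizontal B i x) : x = node B (some i) := by
  refine eq_toSphere _ h3 ?_
  have e0 := horizontal_vertexVec B i 0
  have e2 := horizontal_vertexVec B i 2
  simp only [add_zero] at e0
  apply eq_of_coordinates (B := B) i <;> simp [nodeVec, h1, h2, e0, e2, height_vertexVec]

theorem eq_node_none {x : S2} (i : Fin 6) (h1 : horizontal B i x = 0)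
    (h2 : horizontal B (i + 2) x = 0) (h3 : height B x ≤ 0) : x = node B none := by
  refine eq_toSphere _ (neg_nonneg.2 h3) ?_
  apply eq_of_coordinates (B := B) i <;>
    simp [nodeVec, h1, h2, height_basis_two, horizontal_basis_two]

theorem arc_toSphere {p q : E3} (hp : p ≠ 0) (hq : q ≠ 0) :
    arc (toSphere p hp) (toSphere q hq) = arc p q := by
  have hp' : 0 < ‖p‖ := norm_pos_iff.2 hp
  have hq' : 0 < ‖q‖ := norm_pos_iff.2 hq
  ext x
  constructor
  · rintro ⟨r, s, hr, hs, h⟩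
    exact ⟨r * ‖p‖⁻¹, s * ‖q‖⁻¹, by positivity, by positivity, by
      rw [h, toSphere, toSphere, smul_smul, smul_smul]⟩
  · rintro ⟨r, s, hr, hs, h⟩
    exact ⟨r * ‖p‖, s * ‖q‖, by positivity, by positivity, by
      rw [h, toSphere, toSphere, smul_smul, smul_smul, mul_assoc, mul_assoc,
        mul_inv_cancel₀ hp'.ne', mul_inv_cancel₀ hq'.ne', mul_one, mul_one]⟩

end Coordinates

/-- The sides and the short diagonals of the hexagon, and the edges to the pole below it. -/
inductive Edge
  | side (i : Fin 6)
  | diag (i : Fin 6)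
  | spoke (i : Fin 6)

namespace Edge

/-- The first endpoint of an edge. -/
def fst : Edge → Option (Fin 6)
  | side i => some i
  | diag i => some i
  | spoke i => some i

/-- The second endpoint of an edge. -/
def snd : Edge → Option (Fin 6)
  | side i => some (i + 1)
  | diag i => some (i + 2)
  | spoke _ => none

/-- The point set of an edge on the unit sphere. -/
def pts (B : OrthonormalBasis (Fin 3) ℝ E3) : Edge → Set S2
  | side i => {x | height B x = horizontal B (i + 1) x ∧ 0 ≤ horizontal B i x ∧
      0 ≤ horizontal B (i + 2) x}
  | diag i => {x | height B x = horizontal B (i + 1) x + horizontal B (i + 2) x ∧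
      0 ≤ horizontal B (i + 1) x ∧ 0 ≤ horizontal B (i + 2) x}
  | spoke i => {x | horizontal B (i + 2) x = 0 ∧ 0 ≤ horizontal B i x ∧
      height B x ≤ horizontal B i x}

variable {B : OrthonormalBasis (Fin 3) ℝ E3}

/-- The inequalities in `pts` say that the coefficients of `x` along the two end vectors are
nonnegative. They are `hᵢ, hᵢ₊₂` for a side, `hᵢ₊₁, hᵢ₊₂` for a diagonal, and `hᵢ, hᵢ - height` for
a spoke, where `hⱼ` is `horizontal B j`. -/
theorem pts_eq_arc (e : Edge) : e.pts B = arc (node B e.fst) (node B e.snd) := by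
  rw [node, node, arc_toSphere]
  cases e with
  | side i =>
    have e0 := horizontal_vertexVec B i 0
    have e2 := horizontal_vertexVec B i 2
    have f0 := horizontal_vertexVec B (i + 1) 5
    have f2 := horizontal_vertexVec B (i + 1) 1
    simp [add_assoc] at e0 e2 f0 f2
    ext x
    simp only [pts, arc, fst, snd, nodeVec, mem_ofPred_eq]
    constructor
    · rintro ⟨h1, h2, h3⟩
      refine ⟨_, _, h2, h3, ?_⟩
      apply eq_of_coordinates (B := B) i <;>
        simp [e0, e2, f0, f2, height_vertexVec, h1, horizontal_add_one]
    · rintro ⟨r, s, hr, hs, h⟩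
      rw [h]
      simp [e0, e2, f0, f2, height_vertexVec, horizontal_add_one, hr, hs]
  | diag i =>
    have e0 := horizontal_vertexVec B i 0
    have e2 := horizontal_vertexVec B i 2
    have f0 := horizontal_vertexVec B (i + 2) 4
    have f2 := horizontal_vertexVec B (i + 2) 0
    simp [add_assoc] at e0 e2 f0 f2
    ext x
    simp only [pts, arc, fst, snd, nodeVec, mem_ofPred_eq]
    constructor
    · rintro ⟨h1, h2, h3⟩
      refine ⟨_, _, h2, h3, ?_⟩
      apply eq_of_coordinates (B := B) i <;>
        simp [e0, e2, f0, f2, height_vertexVec, h1, horizontal_add_one]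
    · rintro ⟨r, s, hr, hs, h⟩
      rw [h]
      simp [e0, e2, f0, f2, height_vertexVec, horizontal_add_one, hr, hs]
  | spoke i =>
    have e0 := horizontal_vertexVec B i 0
    have e2 := horizontal_vertexVec B i 2
    simp at e0 e2
    ext x
    simp only [pts, arc, fst, snd, nodeVec, mem_ofPred_eq]
    constructor
    · rintro ⟨h1, h2, h3⟩
      refine ⟨_, _, h2, sub_nonneg.2 h3, ?_⟩
      apply eq_of_coordinates (B := B) i <;>
        simp [e0, e2, height_vertexVec, h1, horizontal_basis_two, height_basis_two]
    · rintro ⟨r, s, hr, hs, h⟩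
      rw [h]
      simp [e0, e2, height_vertexVec, horizontal_basis_two, height_basis_two, hr, hs]

theorem isClosed_pts (e : Edge) : IsClosed (e.pts B) := by
  have hc : ∀ φ : E3 →L[ℝ] ℝ, Continuous fun x : S2 => φ x := fun φ => by fun_prop
  cases e with
  | side i =>
    exact (isClosed_eq (hc _) (hc _)).inter ((isClosed_le continuous_const (hc _)).inter
      (isClosed_le continuous_const (hc _)))
  | diag i =>
    exact (isClosed_eq (hc _) ((hc _).add (hc _))).inter
      ((isClosed_le continuous_const (hc _)).inter (isClosed_le continuous_const (hc _)))
  | spoke i =>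
    exact (isClosed_eq (hc _) continuous_const).inter
      ((isClosed_le continuous_const (hc _)).inter (isClosed_le (hc _) (hc _)))

/-- Leaves room for the bump, and puts the centre into a face. -/
theorem notMem_pts_of_coe_eq {x : S2} (hx : (x : E3) = B 2) (e : Edge) : x ∉ e.pts B := by
  cases e <;> simp [pts, hx, horizontal_basis_two, height_basis_two]

end Edge

end FlipGraph

/-! ### Incidences of nodes and edges -/

namespace FlipGraph

/-- Reduces a pair of indices to its offset, so that each incidence becomes a linear problem in
`hᵢ`, `hᵢ₊₂` and the height. -/
theorem Fin.exists_eq_add (i j : Fin 6) :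
    j = i + 0 ∨ j = i + 1 ∨ j = i + 2 ∨ j = i + 3 ∨ j = i + 4 ∨ j = i + 5 := by
  decide +revert

variable {B : OrthonormalBasis (Fin 3) ℝ E3}

theorem node_some_ne_none (i : Fin 6) : node B (some i) ≠ node B none := by
  intro h
  have h1 : 0 < height B (node B (some i)) := by
    have := norm_pos_iff.2 (nodeVec_ne_zero B (some i))
    simp only [node, toSphere, map_smul, smul_eq_mul, nodeVec, height_vertexVec]
    rw [nodeVec] at this
    positivity
  have h2 : height B (node B none) < 0 := by
    have := norm_pos_iff.2 (nodeVec_ne_zero B none)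
    simp only [node, toSphere, map_smul, smul_eq_mul, nodeVec, map_neg, height_basis_two]
    rw [nodeVec] at this
    rw [mul_neg, mul_one, neg_lt_zero]
    positivity
  rw [h] at h1
  exact lt_asymm h1 h2

theorem height_node (i : Fin 6) : 0 < height B (node B (some i)) ∧
    horizontal B i (node B (some i)) = height B (node B (some i)) ∧
    horizontal B (i + 2) (node B (some i)) = 0 := by
  have := norm_pos_iff.2 (nodeVec_ne_zero B (some i))
  have e0 := horizontal_vertexVec B i 0
  have e2 := horizontal_vertexVec B i 2
  simp only [node, toSphere, map_smul, smul_eq_mul, nodeVec, height_vertexVec] at this ⊢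
  simp at e0 e2
  rw [e0, e2]
  simp [this]

theorem node_injective : Function.Injective (node B) := by
  rintro (_ | i) (_ | j) h
  · rfl
  · exact absurd h.symm (node_some_ne_none j)
  · exact absurd h (node_some_ne_none i)
  · obtain ⟨h1, h2, h3⟩ := height_node (B := B) i
    obtain ⟨h4, h5, h6⟩ := height_node (B := B) j
    rw [← h] at h4 h5 h6
    rcases Fin.exists_eq_add i j with rfl | rfl | rfl | rfl | rfl | rfl
    · simp
    all_goals
      exfalso
      simp only [add_assoc, Fin.reduceAdd, add_zero, horizontal_add_one, horizontal_add_three,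
        horizontal_add_four, horizontal_add_five] at h5 h6
      linarith

theorem eq_zero_or_of_sphere (i : Fin 6) (x : S2) (h1 : horizontal B i x = 0)
    (h2 : horizontal B (i + 2) x = 0) (h3 : height B x = 0) : False :=
  coe_ne_zero x (eq_zero_of_coordinates i h1 h2 h3)

namespace Edge

/-- Two diagonals cross if they start at successive vertices. -/
def Crosses (e f : Edge) : Prop := ∃ i, e = diag i ∧ f = diag (i + 1)

/-- Edges that do not cross meet only in common endpoints. -/
theorem exists_common_node {e f : Edge} (hne : e ≠ f) (h1 : ¬ Crosses e f) (h2 : ¬ Crosses f e)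
    {x : S2} (he : x ∈ e.pts B) (hf : x ∈ f.pts B) :
    ∃ m, (m = e.fst ∨ m = e.snd) ∧ (m = f.fst ∨ m = f.snd) ∧ x = node B m := by
  have hz := fun i => eq_zero_or_of_sphere (B := B) i x
  have h1' : ∀ i, e = diag i → f ≠ diag (i + 1) := fun i hi hj => h1 ⟨i, hi, hj⟩
  have h2' : ∀ i, f = diag (i + 5) → e ≠ diag i := fun i hi hj =>
    h2 ⟨i + 5, hi, by simpa [add_assoc] using hj⟩
  rcases e with i | i | i <;> rcases f with j | j | j <;>
    rcases Fin.exists_eq_add i j with rfl | rfl | rfl | rfl | rfl | rfl <;>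
    first
    | exact absurd (congrArg _ (add_zero i).symm) hne
    | exact absurd rfl (h1' i rfl)
    | exact absurd rfl (h2' i rfl)
    | skip
  all_goals
    simp only [pts, mem_ofPred_eq, add_assoc, Fin.reduceAdd, add_zero, horizontal_add_one,
      horizontal_add_three, horizontal_add_four, horizontal_add_five] at he hf
  all_goals
    obtain ⟨p1, p2, p3⟩ := he
    obtain ⟨q1, q2, q3⟩ := hf
  all_goals
    -- In each remaining case the linear conditions either force `x = 0`, or make `x` a node `i`, `i
    -- + 1`, `i + 2` or the pole.
    first
    | exfalso; refine hz i ?_ ?_ ?_ <;> linarith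
    | refine ⟨some i, by simp [fst], by simp [fst, snd, add_assoc],
        eq_node_some i ?_ ?_ ?_⟩ <;> linarith
    | refine ⟨some (i + 1), by simp [fst, snd], by simp [fst, snd, add_assoc],
        eq_node_some (i + 1) ?_ ?_ ?_⟩
      all_goals
        try simp only [add_assoc, Fin.reduceAdd, horizontal_add_one, horizontal_add_three]
        linarith
    | refine ⟨some (i + 2), by simp [fst, snd], by simp [fst, snd, add_assoc],
        eq_node_some (i + 2) ?_ ?_ ?_⟩
      all_goals
        try simp only [add_assoc, Fin.reduceAdd, horizontal_add_four]
        linarith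
    | refine ⟨none, by simp [snd], by simp [snd],
        eq_node_none i ?_ ?_ ?_⟩ <;> linarith

/-- Crossing diagonals meet. -/
theorem Crosses.exists_mem {e f : Edge} (h : Crosses e f) : ∃ x, x ∈ e.pts B ∧ x ∈ f.pts B := by
  obtain ⟨i, rfl, rfl⟩ := h
  have e0 := horizontal_vertexVec B i 0
  have e2 := horizontal_vertexVec B i 2
  have f0 := horizontal_vertexVec B (i + 2) 4
  have f2 := horizontal_vertexVec B (i + 2) 0
  simp [add_assoc] at e0 e2 f0 f2
  -- The crossing point divides the first diagonal, in the plane of the hexagon, in the ratio `2 :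
  -- 1`.
  set p : E3 := vertexVec B i + (2 : ℝ) • vertexVec B (i + 2) with hp
  have c0 : horizontal B i p = -1 := by rw [hp]; simp [e0, f0]; norm_num
  have c2 : horizontal B (i + 2) p = 2 := by rw [hp]; simp [e2, f2]
  have ch : height B p = 3 := by rw [hp]; simp [height_vertexVec]; norm_num
  have hp0 : p ≠ 0 := ne_zero_of_apply_ne_zero (φ := height B) (by rw [ch]; norm_num)
  have hn : 0 < ‖p‖⁻¹ := inv_pos.2 (norm_pos_iff.2 hp0)
  refine ⟨toSphere p hp0, ?_, ?_⟩ <;>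
    simp only [pts, toSphere, mem_ofPred_eq, map_smul, smul_eq_mul, add_assoc, Fin.reduceAdd,
      horizontal_add_one, horizontal_add_three, c0, c2, ch] <;>
    refine ⟨?_, ?_, ?_⟩ <;> nlinarith

end Edge

end FlipGraph

/-! ### Cycles of three edges, arcs from the centre, and triangles -/

namespace FlipGraph

variable {B : OrthonormalBasis (Fin 3) ℝ E3}

namespace Edge

/-- The edge `e` joins the nodes `a` and `b`. -/
def Joins (e : Edge) (a b : Option (Fin 6)) : Prop :=
  (e.fst = a ∧ e.snd = b) ∨ (e.fst = b ∧ e.snd = a)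

theorem Joins.eq {e f : Edge} {a b : Option (Fin 6)} (he : e.Joins a b) (hf : f.Joins a b) :
    e = f := by
  have h1 : ∀ i j : Fin 6, i = j + 1 → i + 1 = j → False := by decide
  have h2 : ∀ i j : Fin 6, i = j + 2 → i + 2 = j → False := by decide
  have h3 : ∀ i j : Fin 6, i = j + 1 → i + 2 = j → False := by decide
  have h4 : ∀ i j : Fin 6, i = j + 2 → i + 1 = j → False := by decide
  have h5 : ∀ i j : Fin 6, i = j → i + 1 = j + 2 → False := by decide
  have h6 : ∀ i j : Fin 6, i = j → i + 2 = j + 1 → False := by decide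
  rcases e with i | i | i <;> rcases f with j | j | j <;>
    rcases he with ⟨rfl, rfl⟩ | ⟨rfl, rfl⟩ <;> rcases hf with ⟨p, q⟩ | ⟨p, q⟩ <;>
    simp only [fst, snd, Option.some.injEq, reduceCtorEq] at p q <;> grind

/-- Two nodes that are joined by an edge. -/
def joined : Option (Fin 6) → Option (Fin 6) → Bool
  | some i, some j => j = i + 1 || j = i + 2 || i = j + 1 || i = j + 2
  | some _, none => true
  | none, some _ => true
  | none, none => false

theorem Joins.joined {e : Edge} {a b : Option (Fin 6)} (h : e.Joins a b) : joined a b = true := by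
  rcases e with i | i | i <;> rcases h with ⟨rfl, rfl⟩ | ⟨rfl, rfl⟩ <;> simp [Edge.joined, fst, snd]

theorem exists_joins {a b : Option (Fin 6)} (h : joined a b = true) : ∃ e : Edge, e.Joins a b := by
  rcases a with _ | i <;> rcases b with _ | j
  · simp [Edge.joined] at h
  · exact ⟨spoke j, Or.inr ⟨rfl, rfl⟩⟩
  · exact ⟨spoke i, Or.inl ⟨rfl, rfl⟩⟩
  · simp only [Edge.joined, Bool.or_eq_true, decide_eq_true_eq] at h
    rcases h with ((rfl | rfl) | rfl) | rfl
    · exact ⟨side i, Or.inl ⟨rfl, rfl⟩⟩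
    · exact ⟨diag i, Or.inl ⟨rfl, rfl⟩⟩
    · exact ⟨side j, Or.inr ⟨rfl, rfl⟩⟩
    · exact ⟨diag j, Or.inr ⟨rfl, rfl⟩⟩

/-- The edge between `a` and `b` (if there is one) does not meet the shortest path from the
centre to the `k`-th vertex. -/
def avoids (k : Fin 6) (a b : Option (Fin 6)) : Bool :=
  a ≠ some k && b ≠ some k && !(a = some (k + 1) && b = some (k + 5)) &&
    !(a = some (k + 5) && b = some (k + 1))

/-- A cycle of three edges is a central triangle, or it misses the path from the centre to one of
the vertices. -/
theorem joined_cycle : ∀ a b c : Option (Fin 6), joined a b = true → joined b c = true →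
    joined c a = true →
    (∃ i : Fin 6, (a = some i ∧ b = some (i + 2) ∧ c = some (i + 4)) ∨
      (a = some (i + 4) ∧ b = some (i + 2) ∧ c = some i)) ∨
    ∃ k, avoids k a b = true ∧ avoids k b c = true ∧ avoids k c a = true := by
  decide

variable (B) in
/-- The short path from the centre to the `k`-th vertex. -/
def meridian (k : Fin 6) : Set S2 :=
  {x | horizontal B (k + 2) x = 0 ∧ 0 ≤ horizontal B k x ∧ horizontal B k x ≤ height B x}

theorem height_pos_of_mem_meridian {k : Fin 6} {x : S2} (hx : x ∈ meridian B k) :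
    0 < height B x := by
  obtain ⟨h1, h2, h3⟩ := hx
  refine (h2.trans h3).lt_of_ne fun h => ?_
  exact eq_zero_or_of_sphere k x (by linarith) h1 h.symm

theorem notMem_meridian {k : Fin 6} {e : Edge} (h : avoids k e.fst e.snd = true) {x : S2}
    (hx : x ∈ e.pts B) : x ∉ meridian B k := by
  intro hm
  have hpos := height_pos_of_mem_meridian hm
  obtain ⟨h1, h2, h3⟩ := hm
  rcases e with j | j | j <;>
    rcases Fin.exists_eq_add k j with rfl | rfl | rfl | rfl | rfl | rfl <;>
    simp [avoids, fst, snd, add_assoc] at h <;>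
    simp only [pts, mem_ofPred_eq, add_assoc, Fin.reduceAdd, add_zero, horizontal_add_one,
      horizontal_add_three, horizontal_add_four, horizontal_add_five] at hx <;>
    obtain ⟨p1, p2, p3⟩ := hx <;> linarith

theorem isPreconnected_meridian (k : Fin 6) : IsPreconnected (meridian B k) := by
  rw [← IsInducing.subtypeVal.isPreconnected_image]
  -- Positivity of the height holds on the arc anyway; imposing it removes the origin and keeps the
  -- cone convex.
  set s : Set E3 := {x | horizontal B (k + 2) x = 0} ∩ ({x | 0 ≤ horizontal B k x} ∩
    ({x | 0 ≤ (height B - horizontal B k) x} ∩ {x | 0 < height B x})) with hs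
  have hconv : Convex ℝ s := (convex_hyperplane (horizontal B (k + 2)).isLinear 0).inter
    ((convex_halfSpace_ge (horizontal B k).isLinear 0).inter
      ((convex_halfSpace_ge (height B - horizontal B k).isLinear 0).inter
        (convex_halfSpace_gt (height B).isLinear 0)))
  have himg : Subtype.val '' meridian B k = (fun x : E3 => ‖x‖⁻¹ • x) '' s := by
    ext y
    constructor
    · rintro ⟨x, hx, rfl⟩
      refine ⟨x, ⟨hx.1, hx.2.1, ?_, height_pos_of_mem_meridian hx⟩, by simp⟩
      simpa using hx.2.2
    · rintro ⟨x, ⟨h1, h2, h3, h4⟩, rfl⟩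
      have hx0 : x ≠ 0 := ne_zero_of_apply_ne_zero (φ := height B) h4.ne'
      have hn : 0 < ‖x‖⁻¹ := inv_pos.2 (norm_pos_iff.2 hx0)
      simp only [mem_ofPred_eq, sub_apply, sub_nonneg] at h1 h2 h3
      refine ⟨toSphere x hx0, ⟨?_, ?_, ?_⟩, rfl⟩ <;>
        simp only [toSphere, map_smul, smul_eq_mul]
      · rw [h1, mul_zero]
      · positivity
      · gcongr
  rw [himg]
  refine hconv.isPreconnected.image _ fun x hx => ?_
  have hx0 : x ≠ 0 := ne_zero_of_apply_ne_zero (φ := height B) hx.2.2.2.ne'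
  exact (ContinuousAt.smul (ContinuousAt.inv₀ (by fun_prop) (norm_ne_zero_iff.2 hx0))
    (by fun_prop)).continuousWithinAt

theorem node_mem_meridian (k : Fin 6) : node B (some k) ∈ meridian B k := by
  obtain ⟨h1, h2, h3⟩ := height_node (B := B) k
  exact ⟨h3, by rw [h2]; exact h1.le, h2.le⟩

theorem mem_meridian_of_coe_eq {x : S2} (hx : (x : E3) = B 2) (k : Fin 6) : x ∈ meridian B k := by
  simp [meridian, hx, horizontal_basis_two, height_basis_two]

end Edge

open Edge

/-- The triangles that are bounded by three edges and not crossed by the short diagonals of the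
same kind. -/
inductive Tri
  | outer (i : Fin 6)
  | corner (i : Fin 6)
  | central (i : Fin 6)

namespace Tri

variable (B) in
/-- The linear functionals that define a triangle. -/
noncomputable def cell : Tri → Fin 3 → E3 →L[ℝ] ℝ
  | outer i => ![horizontal B i, horizontal B (i + 2), horizontal B (i + 1) - height B]
  | corner i => ![height B - horizontal B (i + 1), height B - horizontal B (i + 2),
      horizontal B (i + 1) + horizontal B (i + 2) - height B]
  | central i => ![height B - horizontal B (i + 1) - horizontal B (i + 2),
      height B - horizontal B (i + 3) - horizontal B (i + 4),
      height B - horizontal B (i + 5) - horizontal B i]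

/-- The vertices of a triangle. -/
def vertex : Tri → Fin 3 → Option (Fin 6)
  | outer i => ![some i, some (i + 1), none]
  | corner i => ![some i, some (i + 1), some (i + 2)]
  | central i => ![some i, some (i + 2), some (i + 4)]

/-- The sides of a triangle. -/
def edge : Tri → Fin 3 → Edge
  | outer i => ![side i, spoke (i + 1), spoke i]
  | corner i => ![side i, side (i + 1), diag i]
  | central i => ![diag i, diag (i + 2), diag (i + 4)]

theorem joins_edge (t : Tri) (k : Fin 3) : (t.edge k).Joins (t.vertex k) (t.vertex (k + 1)) := by
  cases t <;> fin_cases k <;> simp [edge, vertex, Joins, fst, snd, add_assoc]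

theorem vertex_ne (t : Tri) (k : Fin 3) : t.vertex k ≠ t.vertex (k + 1) := by
  cases t <;> fin_cases k <;> simp [vertex]

end Tri

theorem exists_coordinates (i : Fin 6) (a b z : ℝ) :
    ∃ v : E3, horizontal B i v = a ∧ horizontal B (i + 2) v = b ∧ height B v = z := by
  have e0 := horizontal_vertexVec B i 0
  have e2 := horizontal_vertexVec B i 2
  have f0 := horizontal_vertexVec B (i + 1) 5
  have f2 := horizontal_vertexVec B (i + 1) 1
  simp [add_assoc] at e0 e2 f0 f2
  -- In the coordinates `(hᵢ, hᵢ₊₂, height)` these three vectors are `(1, 0, 1)`, `(0, 1, 1)` and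
  -- `(0, 0, 1)`.
  refine ⟨a • vertexVec B i + b • vertexVec B (i + 1) + (z - a - b) • B 2, ?_, ?_, ?_⟩ <;>
    simp [e0, e2, f0, f2, horizontal_basis_two, height_basis_two, height_vertexVec]

namespace Tri

theorem mem_openCell_outer {i : Fin 6} {x : S2} : x ∈ openCell (cell B (outer i)) ↔
    0 < horizontal B i x ∧ 0 < horizontal B (i + 2) x ∧ height B x < horizontal B (i + 1) x := by
  simp [openCell, cell, Fin.forall_fin_succ]

theorem mem_openCell_corner {i : Fin 6} {x : S2} : x ∈ openCell (cell B (corner i)) ↔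
    horizontal B (i + 1) x < height B x ∧ horizontal B (i + 2) x < height B x ∧
      height B x < horizontal B (i + 1) x + horizontal B (i + 2) x := by
  simp [openCell, cell, Fin.forall_fin_succ]

theorem mem_openCell_central {i : Fin 6} {x : S2} : x ∈ openCell (cell B (central i)) ↔
    horizontal B (i + 1) x + horizontal B (i + 2) x < height B x ∧
      horizontal B (i + 3) x + horizontal B (i + 4) x < height B x ∧
      horizontal B (i + 5) x + horizontal B i x < height B x := by
  simp only [openCell, cell, Fin.forall_fin_succ, mem_ofPred_eq]
  simp [sub_sub]

theorem mem_closedCell_outer {i : Fin 6} {x : S2} : x ∈ closedCell (cell B (outer i)) ↔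
    0 ≤ horizontal B i x ∧ 0 ≤ horizontal B (i + 2) x ∧ height B x ≤ horizontal B (i + 1) x := by
  simp [closedCell, cell, Fin.forall_fin_succ]

theorem mem_closedCell_corner {i : Fin 6} {x : S2} : x ∈ closedCell (cell B (corner i)) ↔
    horizontal B (i + 1) x ≤ height B x ∧ horizontal B (i + 2) x ≤ height B x ∧
      height B x ≤ horizontal B (i + 1) x + horizontal B (i + 2) x := by
  simp [closedCell, cell, Fin.forall_fin_succ]

theorem mem_closedCell_central {i : Fin 6} {x : S2} : x ∈ closedCell (cell B (central i)) ↔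
    horizontal B (i + 1) x + horizontal B (i + 2) x ≤ height B x ∧
      horizontal B (i + 3) x + horizontal B (i + 4) x ≤ height B x ∧
      horizontal B (i + 5) x + horizontal B i x ≤ height B x := by
  simp only [closedCell, cell, Fin.forall_fin_succ, mem_ofPred_eq]
  simp [sub_sub]

theorem exists_mem_openCell (t : Tri) : ∃ x, x ∈ openCell (cell B t) := by
  have key : ∀ v : E3, (∀ k, 0 < cell B t k v) → ∃ x, x ∈ openCell (cell B t) := fun v hv =>
    ⟨toSphere v (ne_zero_of_apply_ne_zero (hv 0).ne'), (toSphere_mem_openCell _).2 hv⟩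
  cases t with
  | outer i =>
    obtain ⟨v, h1, h2, h3⟩ := exists_coordinates (B := B) i 1 1 0
    refine key v fun k => ?_
    fin_cases k <;> simp [cell, horizontal_add_one, h1, h2, h3]
  | corner i =>
    obtain ⟨v, h1, h2, h3⟩ := exists_coordinates (B := B) i 0 2 3
    refine key v fun k => ?_
    fin_cases k <;> simp [cell, horizontal_add_one, h1, h2, h3] <;> norm_num
  | central i =>
    obtain ⟨v, h1, h2, h3⟩ := exists_coordinates (B := B) i 0 0 1
    refine key v fun k => ?_
    fin_cases k <;> simp [cell, horizontal_add_one, horizontal_add_three, horizontal_add_four,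
      horizontal_add_five, h1, h2, h3]

theorem eq_zero_of_cell (t : Tri) (x : E3) (h : ∀ k, cell B t k x = 0) : x = 0 := by
  have h0 := h 0
  have h1 := h 1
  have h2 := h 2
  rcases t with i | i | i <;>
    simp [cell, horizontal_add_one, horizontal_add_three, horizontal_add_four,
      horizontal_add_five] at h0 h1 h2 <;>
    refine eq_zero_of_coordinates (B := B) i ?_ ?_ ?_ <;> linarith

theorem isDisc_closedCell (t : Tri) : IsDisc (closedCell (cell B t)) := by
  obtain ⟨x, hx⟩ := exists_mem_openCell (B := B) t
  exact FlipGraph.isDisc_closedCell hx t.eq_zero_of_cell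

theorem closure_openCell (t : Tri) : closure (openCell (cell B t)) = closedCell (cell B t) := by
  obtain ⟨x, hx⟩ := exists_mem_openCell (B := B) t
  exact FlipGraph.closure_openCell hx

/-- On the frontier one of the three functionals vanishes and the other two are nonnegative; these
conditions cut out one side. -/
theorem frontier_openCell (t : Tri) : frontier (openCell (cell B t)) =
    (t.edge 0).pts B ∪ (t.edge 1).pts B ∪ (t.edge 2).pts B := by
  obtain ⟨x, hx⟩ := exists_mem_openCell (B := B) t
  rw [FlipGraph.frontier_openCell hx]
  ext y
  rw [mem_sdiff]
  rcases t with i | i | i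
  · rw [mem_openCell_outer, mem_closedCell_outer]
    simp only [edge, pts, Matrix.cons_val, mem_union, mem_ofPred_eq, add_assoc, Fin.reduceAdd,
      horizontal_add_one, horizontal_add_three]
    constructor
    · rintro ⟨⟨h1, h2, h3⟩, h4⟩
      by_contra! hcon
      refine h4 ⟨h1.lt_of_ne fun h => ?_, h2.lt_of_ne fun h => ?_, h3.lt_of_ne fun h => ?_⟩
      · have := hcon.1.2 (by linarith) (by linarith); linarith
      · have := hcon.2 (by linarith) (by linarith); linarith
      · have := hcon.1.1 (by linarith) (by linarith); linarith
    · rintro ((⟨h1, h2, h3⟩ | ⟨h1, h2, h3⟩) | ⟨h1, h2, h3⟩) <;>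
        refine ⟨⟨?_, ?_, ?_⟩, ?_⟩ <;> first | linarith | (rintro ⟨h4, h5, h6⟩; linarith)
  · rw [mem_openCell_corner, mem_closedCell_corner]
    simp only [edge, pts, Matrix.cons_val, mem_union, mem_ofPred_eq, add_assoc, Fin.reduceAdd,
      horizontal_add_one, horizontal_add_three]
    constructor
    · rintro ⟨⟨h1, h2, h3⟩, h4⟩
      by_contra! hcon
      refine h4 ⟨h1.lt_of_ne fun h => ?_, h2.lt_of_ne fun h => ?_, h3.lt_of_ne fun h => ?_⟩
      · have := hcon.1.1 (by linarith) (by linarith); linarith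
      · have := hcon.1.2 (by linarith) (by linarith); linarith
      · have := hcon.2 (by linarith) (by linarith); linarith
    · rintro ((⟨h1, h2, h3⟩ | ⟨h1, h2, h3⟩) | ⟨h1, h2, h3⟩) <;>
        refine ⟨⟨?_, ?_, ?_⟩, ?_⟩ <;> first | linarith | (rintro ⟨h4, h5, h6⟩; linarith)
  · rw [mem_openCell_central, mem_closedCell_central]
    simp only [edge, pts, Matrix.cons_val, mem_union, mem_ofPred_eq, add_assoc, Fin.reduceAdd,
      horizontal_add_one, horizontal_add_three, horizontal_add_four, horizontal_add_five, add_zero]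
    constructor
    · rintro ⟨⟨h1, h2, h3⟩, h4⟩
      by_contra! hcon
      refine h4 ⟨h1.lt_of_ne fun h => ?_, h2.lt_of_ne fun h => ?_, h3.lt_of_ne fun h => ?_⟩
      · have := hcon.1.1 (by linarith) (by linarith); linarith
      · have := hcon.1.2 (by linarith) (by linarith); linarith
      · have := hcon.2 (by linarith) (by linarith); linarith
    · rintro ((⟨h1, h2, h3⟩ | ⟨h1, h2, h3⟩) | ⟨h1, h2, h3⟩) <;>
        refine ⟨⟨?_, ?_, ?_⟩, ?_⟩ <;> first | linarith | (rintro ⟨h4, h5, h6⟩; linarith)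

end Tri

end FlipGraph

/-! ### The hexagon and the two subdivisions into triangles -/

namespace FlipGraph

variable {B : OrthonormalBasis (Fin 3) ℝ E3}

/-- `i` and `o` have the same parity. -/
def SameParity (o i : Fin 6) : Prop := i = o ∨ i = o + 2 ∨ i = o + 4

theorem SameParity.eq_add {o i j : Fin 6} (hi : SameParity o i) (hj : SameParity o j) :
    j = i + 0 ∨ j = i + 2 ∨ j = i + 4 := by
  unfold SameParity at hi hj
  decide +revert

theorem SameParity.add_two {o i : Fin 6} (hi : SameParity o i) : SameParity o (i + 2) := by
  unfold SameParity at *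
  decide +revert

theorem SameParity.add_four {o i : Fin 6} (hi : SameParity o i) : SameParity o (i + 4) := by
  unfold SameParity at *
  decide +revert

theorem sameParity_or (i : Fin 6) : SameParity 0 i ∨ SameParity 1 i := by
  unfold SameParity
  decide +revert

theorem not_sameParity_and (i : Fin 6) : ¬ (SameParity 0 i ∧ SameParity 1 i) := by
  unfold SameParity
  decide +revert

theorem not_sameParity_add_one (o i : Fin 6) : ¬ (SameParity o i ∧ SameParity o (i + 1)) := by
  unfold SameParity
  decide +revert

theorem sameParity_add_one {o i : Fin 6} (h : ¬ SameParity o i) : SameParity o (i + 1) := by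
  unfold SameParity at *
  decide +revert

open Edge

/-- The sides, and the diagonals of one of the two kinds. -/
def polygonEdges (o : Fin 6) : Set Edge :=
  {e | match e with
    | side _ => True
    | diag i => SameParity o i
    | spoke _ => False}

/-- The edges to the pole and the sides, and the diagonals of one of the two kinds. -/
def sphereEdges (o : Fin 6) : Set Edge :=
  {e | match e with
    | side _ => True
    | diag i => SameParity o i
    | spoke _ => True}

theorem polygonEdges_subset (o : Fin 6) : polygonEdges o ⊆ sphereEdges o := by
  rintro (i | i | i) h
  · trivial
  · exact h
  · trivial

variable (B) in
/-- The linear functionals that define the hexagon. -/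
noncomputable def hexagon (j : Fin 6) : E3 →L[ℝ] ℝ := height B - horizontal B j

theorem mem_openCell_hexagon {x : S2} :
    x ∈ openCell (hexagon B) ↔ ∀ j, horizontal B j x < height B x := by
  simp [openCell, hexagon]

theorem mem_closedCell_hexagon {x : S2} :
    x ∈ closedCell (hexagon B) ↔ ∀ j, horizontal B j x ≤ height B x := by
  simp [closedCell, hexagon]

theorem mem_closedCell_hexagon_of {x : S2} (i : Fin 6) (h0 : horizontal B i x ≤ height B x)
    (h1 : horizontal B i x + horizontal B (i + 2) x ≤ height B x)
    (h2 : horizontal B (i + 2) x ≤ height B x) (h3 : - horizontal B i x ≤ height B x)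
    (h4 : - horizontal B i x - horizontal B (i + 2) x ≤ height B x)
    (h5 : - horizontal B (i + 2) x ≤ height B x) : x ∈ closedCell (hexagon B) := by
  rw [mem_closedCell_hexagon]
  intro j
  rcases Fin.exists_eq_add i j with rfl | rfl | rfl | rfl | rfl | rfl <;>
    simpa only [add_zero, horizontal_add_one, horizontal_add_three, horizontal_add_four,
      horizontal_add_five]

theorem mem_openCell_hexagon_of_coe_eq {x : S2} (hx : (x : E3) = B 2) :
    x ∈ openCell (hexagon B) := by
  rw [mem_openCell_hexagon, hx]
  simp [horizontal_basis_two, height_basis_two]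

theorem exists_mem_openCell_hexagon : ∃ x, x ∈ openCell (hexagon B) :=
  ⟨⟨B 2, by simp⟩, mem_openCell_hexagon_of_coe_eq rfl⟩

/-- The height bounds both `hⱼ` and `-hⱼ`, so it is nonnegative, and if it were zero all coordinates
would vanish. -/
theorem height_pos_of_mem_hexagon {x : S2} (hx : x ∈ closedCell (hexagon B)) :
    0 < height B x := by
  rw [mem_closedCell_hexagon] at hx
  have h0 := hx 0
  have h2 := hx (0 + 2)
  have h3 := hx (0 + 3)
  have h5 := hx (0 + 5)
  rw [horizontal_add_three] at h3
  rw [horizontal_add_five] at h5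
  refine lt_of_le_of_ne (by linarith) fun h => ?_
  exact eq_zero_or_of_sphere (B := B) 0 x (by linarith) (by linarith) h.symm

theorem isDisc_hexagon : IsDisc (closedCell (hexagon B)) := by
  obtain ⟨x, hx⟩ := exists_mem_openCell_hexagon (B := B)
  refine isDisc_closedCell hx fun y hy => ?_
  have h0 := hy 0
  have h2 := hy (0 + 2)
  have h3 := hy (0 + 3)
  have h5 := hy (0 + 5)
  simp only [hexagon, sub_apply, horizontal_add_three, horizontal_add_five] at h0 h2 h3 h5
  refine eq_zero_of_coordinates (B := B) 0 ?_ ?_ ?_ <;> linarith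

/-- If `hᵢ₊₁` equals the height, then `hᵢ, hᵢ₊₂ ≤ hᵢ₊₁ = hᵢ + hᵢ₊₂`, so both are nonnegative and the
point is on side `i`. -/
theorem frontier_hexagon : frontier (closedCell (hexagon B)) = ⋃ i, (side i).pts B := by
  obtain ⟨x, hx⟩ := exists_mem_openCell_hexagon (B := B)
  rw [frontier_closedCell hx]
  ext y
  simp only [mem_sdiff, mem_iUnion]
  constructor
  · rintro ⟨h1, h2⟩
    rw [mem_closedCell_hexagon] at h1
    rw [mem_openCell_hexagon] at h2
    push Not at h2
    obtain ⟨j, hj⟩ := h2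
    obtain ⟨i, rfl⟩ : ∃ i, j = i + 1 := ⟨j - 1, by simp⟩
    refine ⟨i, ?_⟩
    have h3 := h1 i
    have h4 := h1 (i + 1)
    have h5 := h1 (i + 2)
    simp only [pts, mem_ofPred_eq, horizontal_add_one] at *
    refine ⟨?_, ?_, ?_⟩ <;> linarith
  · rintro ⟨i, h1, h2, h3⟩
    have h4 := horizontal_add_one (B := B) i y
    refine ⟨mem_closedCell_hexagon_of (B := B) i ?_ ?_ ?_ ?_ ?_ ?_, fun h => ?_⟩
    · linarith
    · linarith
    · linarith
    · linarith
    · linarith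
    · linarith
    · rw [mem_openCell_hexagon] at h
      exact absurd (h (i + 1)) (not_lt.2 h1.le)

theorem diag_subset_hexagon (i : Fin 6) : (diag i).pts B ⊆ closedCell (hexagon B) := by
  rintro y ⟨h1, h2, h3⟩
  rw [horizontal_add_one] at h1 h2
  refine mem_closedCell_hexagon_of (B := B) i ?_ ?_ ?_ ?_ ?_ ?_ <;> linarith

namespace Tri

/-- The triangles that belong to the diagonals of one of the two kinds. -/
def OfKind (o : Fin 6) : Tri → Prop
  | outer _ => True
  | corner i => SameParity o i
  | central i => SameParity o i

/-- The triangles inside the hexagon. -/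
def Inner : Tri → Prop
  | outer _ => False
  | corner _ => True
  | central _ => True

theorem openCell_subset_hexagon {t : Tri} (ht : t.Inner) :
    openCell (cell B t) ⊆ closedCell (hexagon B) := by
  intro x hx
  rcases t with i | i | i
  · exact ht.elim
  · rw [mem_openCell_corner, horizontal_add_one] at hx
    obtain ⟨h1, h2, h3⟩ := hx
    refine mem_closedCell_hexagon_of (B := B) i ?_ ?_ ?_ ?_ ?_ ?_ <;> linarith
  · rw [mem_openCell_central, horizontal_add_one, horizontal_add_three, horizontal_add_four,
      horizontal_add_five] at hx
    obtain ⟨h1, h2, h3⟩ := hx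
    refine mem_closedCell_hexagon_of (B := B) i ?_ ?_ ?_ ?_ ?_ ?_ <;> linarith

theorem edge_mem_polygonEdges {o : Fin 6} {t : Tri} (ht : t.OfKind o) (hi : t.Inner) (k : Fin 3) :
    t.edge k ∈ polygonEdges o := by
  rcases t with i | i | i
  · exact hi.elim
  · fin_cases k
    · trivial
    · trivial
    · exact ht
  · fin_cases k
    · exact ht
    · exact SameParity.add_two ht
    · exact SameParity.add_four ht

theorem edge_mem_sphereEdges {o : Fin 6} {t : Tri} (ht : t.OfKind o) (k : Fin 3) :
    t.edge k ∈ sphereEdges o := by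
  rcases t with i | i | i
  · fin_cases k <;> trivial
  · exact polygonEdges_subset o (edge_mem_polygonEdges ht trivial k)
  · exact polygonEdges_subset o (edge_mem_polygonEdges ht trivial k)

theorem notMem_openCell {o : Fin 6} {t : Tri} (ht : t.OfKind o) {e : Edge}
    (he : e ∈ sphereEdges o) {x : S2} (hx : x ∈ e.pts B) : x ∉ openCell (cell B t) := by
  intro hc
  rcases t with i | i | i <;> rcases e with j | j | j <;>
    rcases Fin.exists_eq_add i j with rfl | rfl | rfl | rfl | rfl | rfl
  all_goals
    first
    | simp only [pts, mem_openCell_outer, mem_openCell_corner, mem_openCell_central, mem_ofPred_eq,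
        add_assoc, Fin.reduceAdd, add_zero, horizontal_add_one,
        horizontal_add_three, horizontal_add_four, horizontal_add_five] at hx hc
      obtain ⟨p1, p2, p3⟩ := hx
      obtain ⟨q1, q2, q3⟩ := hc
      linarith
    -- What is left are diagonals at an odd offset from the triangle, which do not occur in the same
    -- family.
    | rcases SameParity.eq_add ht he with h | h | h <;> simp at h

/-- A point beyond one of the three diagonals is in the corner cut off by it; otherwise it is in the
central triangle. -/
theorem exists_inner_of_mem_hexagon (o : Fin 6) {x : S2} (hx : x ∈ closedCell (hexagon B))
    (h : ∀ e ∈ polygonEdges o, x ∉ e.pts B) :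
    ∃ t : Tri, t.OfKind o ∧ t.Inner ∧ x ∈ openCell (cell B t) := by
  rw [mem_closedCell_hexagon] at hx
  have key : ∀ i, SameParity o i →
      height B x ≤ horizontal B (i + 1) x + horizontal B (i + 2) x →
      ∃ t : Tri, t.OfKind o ∧ t.Inner ∧ x ∈ openCell (cell B t) := by
    intro i hi hle
    refine ⟨corner i, hi, trivial, ?_⟩
    have h1 := h (side i) trivial
    have h2 := h (side (i + 1)) trivial
    have h3 := h (diag i) hi
    have g1 := hx (i + 1)
    have g2 := hx (i + 2)
    have e3 := horizontal_add_three (B := B) i x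
    have e1 := horizontal_add_one (B := B) i x
    rw [mem_openCell_corner]
    simp only [pts, mem_ofPred_eq, add_assoc, Fin.reduceAdd] at h1 h2 h3
    refine ⟨g1.lt_of_ne fun h => h1 ⟨h.symm, ?_, ?_⟩, g2.lt_of_ne fun h => h2 ⟨h.symm, ?_, ?_⟩,
      hle.lt_of_ne fun h => h3 ⟨h, ?_, ?_⟩⟩ <;> linarith
  have ho : SameParity o o := Or.inl rfl
  by_contra hcon
  have c0 : ¬ height B x ≤ horizontal B (o + 1) x + horizontal B (o + 2) x :=
    fun h => hcon (key o ho h)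
  have c2 := fun h => hcon (key (o + 2) ho.add_two h)
  have c4 := fun h => hcon (key (o + 4) ho.add_four h)
  simp only [add_assoc, Fin.reduceAdd, add_zero, not_le] at c0 c2 c4
  exact hcon ⟨central o, ho, trivial, mem_openCell_central.2 ⟨c0, not_le.1 c2, not_le.1 c4⟩⟩

/-- Outside the hexagon, a largest coordinate `hᵢ₊₁` selects the sector: it exceeds the height, its
maximality makes `hᵢ` and `hᵢ₊₂` nonnegative, and strictness holds off the spokes. -/
theorem exists_of_sphere (o : Fin 6) {x : S2} (h : ∀ e ∈ sphereEdges o, x ∉ e.pts B) :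
    ∃ t : Tri, t.OfKind o ∧ x ∈ openCell (cell B t) := by
  by_cases hx : x ∈ closedCell (hexagon B)
  · obtain ⟨t, h1, -, h2⟩ := exists_inner_of_mem_hexagon o hx fun e he =>
      h e (polygonEdges_subset o he)
    exact ⟨t, h1, h2⟩
  · rw [mem_closedCell_hexagon] at hx
    push Not at hx
    obtain ⟨j, hj⟩ := hx
    obtain ⟨m, hm⟩ := Finite.exists_max fun j => horizontal B j x
    obtain ⟨i, rfl⟩ : ∃ i, m = i + 1 := ⟨m - 1, by simp⟩
    have h0 := hm i
    have h2 := hm (i + 2)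
    have hj' := hm j
    have e1 := horizontal_add_one (B := B) i x
    have e3 := horizontal_add_three (B := B) i x
    have g0 := h (spoke i) trivial
    have g1 := h (spoke (i + 1)) trivial
    simp only [pts, mem_ofPred_eq, add_assoc, Fin.reduceAdd] at g0 g1
    refine ⟨outer i, trivial, ?_⟩
    rw [mem_openCell_outer]
    refine ⟨lt_of_le_of_ne (by linarith) fun h => g1 ⟨?_, ?_, ?_⟩,
      lt_of_le_of_ne (by linarith) fun h => g0 ⟨?_, ?_, ?_⟩, ?_⟩ <;> linarith

end Tri

end FlipGraph

/-! ### Transfer to a surface that realizes the edges as segments -/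

namespace FlipGraph

open Edge

section Surface

variable {M : Type*} [MetricSpace M]

/-- The points of the surface over the vertices of the hexagon and the pole below it. -/
noncomputable def point (Φ : M ≃ₜ S2) (B : OrthonormalBasis (Fin 3) ℝ E3) (m : Option (Fin 6)) :
    M :=
  Φ.symm (node B m)

/-- The edges on the surface. -/
def seg (Φ : M ≃ₜ S2) (B : OrthonormalBasis (Fin 3) ℝ E3) (e : Edge) : Set M := Φ ⁻¹' e.pts B

/-- The edges are segments of the surface, and opposite vertices do not define a segment. -/
structure RealizesEdges (Φ : M ≃ₜ S2) (B : OrthonormalBasis (Fin 3) ℝ E3) : Prop where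
  isSegment : ∀ e : Edge, IsSegment (point Φ B e.fst) (point Φ B e.snd) (seg Φ B e)
  not_isSegment : ∀ i s, ¬ IsSegment (point Φ B (some i)) (point Φ B (some (i + 3))) s

variable {Φ : M ≃ₜ S2} {B : OrthonormalBasis (Fin 3) ℝ E3}

theorem point_injective : Function.Injective (point Φ B) :=
  Φ.symm.injective.comp node_injective

theorem apply_point (m : Option (Fin 6)) : Φ (point Φ B m) = node B m := Φ.apply_symm_apply _

theorem eq_point {x : M} {m : Option (Fin 6)} (h : Φ x = node B m) : x = point Φ B m := by
  rw [point, ← h, Φ.symm_apply_apply]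

namespace RealizesEdges

theorem isSegment_of_joins (h : RealizesEdges Φ B) {e : Edge} {a b : Option (Fin 6)}
    (he : e.Joins a b) :
    IsSegment (point Φ B a) (point Φ B b) (seg Φ B e) := by
  rcases he with ⟨rfl, rfl⟩ | ⟨rfl, rfl⟩
  · exact h.isSegment e
  · exact (h.isSegment e).symm

theorem exists_joins_of_isSegment (h : RealizesEdges Φ B) {e : Edge} {x y : M}
    (hs : IsSegment x y (seg Φ B e)) :
    ∃ a b, x = point Φ B a ∧ y = point Φ B b ∧ e.Joins a b := by
  rcases (h.isSegment e).1.endpoints hs.1 with ⟨rfl, rfl⟩ | ⟨rfl, rfl⟩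
  · exact ⟨_, _, rfl, rfl, Or.inl ⟨rfl, rfl⟩⟩
  · exact ⟨_, _, rfl, rfl, Or.inr ⟨rfl, rfl⟩⟩

theorem joins_of_isSegment (h : RealizesEdges Φ B) {e : Edge} {a b : Option (Fin 6)}
    (hs : IsSegment (point Φ B a) (point Φ B b) (seg Φ B e)) : e.Joins a b := by
  obtain ⟨a', b', h1, h2, h3⟩ := h.exists_joins_of_isSegment hs
  rwa [point_injective h1, point_injective h2]

theorem seg_injective (h : RealizesEdges Φ B) : Function.Injective (seg Φ B) := by
  intro e f hef
  have := h.isSegment f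
  rw [← hef] at this
  exact (h.joins_of_isSegment this).eq (Or.inl ⟨rfl, rfl⟩)

/-- The only distinct nodes not joined by an edge are opposite vertices, and those define no
segment. -/
theorem exists_eq_seg (h : RealizesEdges Φ B) {a b : Option (Fin 6)} (hab : a ≠ b) {s : Set M}
    (hs : IsSegment (point Φ B a) (point Φ B b) s) : ∃ e : Edge, e.Joins a b ∧ s = seg Φ B e := by
  have hj : joined a b = true := by
    rcases a with _ | i <;> rcases b with _ | j
    · exact absurd rfl hab
    · rfl
    · rfl
    · rcases Fin.exists_eq_add i j with rfl | rfl | rfl | rfl | rfl | rfl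
      · simp at hab
      · simp [joined]
      · simp [joined]
      · exact absurd hs (h.not_isSegment i s)
      · simp [joined, add_assoc]
      · simp [joined, add_assoc]
  obtain ⟨e, he⟩ := exists_joins hj
  exact ⟨e, he, hs.eq (h.isSegment_of_joins he)⟩

/-- Makes the metric condition combinatorial: crossing diagonals meet but have four different ends,
and all other pairs meet only in common nodes. -/
theorem nonCrossing_image_iff (h : RealizesEdges Φ B) {A : Set Edge} :
    NonCrossing (seg Φ B '' A) ↔ ∀ e ∈ A, ∀ f ∈ A, ¬ Crosses e f := by
  constructor
  · rintro hn e he f hf hc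
    obtain ⟨x, hx, hy⟩ := hc.exists_mem (B := B)
    obtain ⟨i, rfl, rfl⟩ := hc
    have hne : seg Φ B (diag i) ≠ seg Φ B (diag (i + 1)) := fun h' => by
      simpa using h.seg_injective h'
    have hxy : Φ.symm x ∈ seg Φ B (diag i) ∩ seg Φ B (diag (i + 1)) :=
      ⟨by simpa [seg] using hx, by simpa [seg] using hy⟩
    have hmem := hn _ ⟨_, he, rfl⟩ _ ⟨_, hf, rfl⟩ hne _ _ _ _ (h.isSegment _) (h.isSegment _) hxy
    simp only [fst, snd] at hmem
    obtain ⟨h1 | h1, h2 | h2⟩ := hmem <;> rw [h1] at h2 <;>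
      simpa [add_assoc] using point_injective h2
  · rintro hA _ ⟨e, he, rfl⟩ _ ⟨f, hf, rfl⟩ hne a b c d hab hcd x ⟨hx, hy⟩
    obtain ⟨m, hm1, hm2, hm⟩ := exists_common_node (fun h' => hne (congrArg _ h')) (hA e he f hf)
      (hA f hf e he) hx hy
    rw [eq_point hm]
    refine ⟨?_, ?_⟩
    · rcases (h.isSegment e).1.endpoints hab.1 with ⟨rfl, rfl⟩ | ⟨rfl, rfl⟩ <;>
        rcases hm1 with rfl | rfl <;> simp
    · rcases (h.isSegment f).1.endpoints hcd.1 with ⟨rfl, rfl⟩ | ⟨rfl, rfl⟩ <;>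
        rcases hm2 with rfl | rfl <;> simp

theorem sides_eq (h : RealizesEdges Φ B) :
    sides (fun i => point Φ B (some i)) = seg Φ B '' range side := by
  ext s
  constructor
  · rintro ⟨i, hs⟩
    exact ⟨side i, ⟨i, rfl⟩, (h.isSegment (side i)).eq hs⟩
  · rintro ⟨_, ⟨i, rfl⟩, rfl⟩
    exact ⟨i, h.isSegment (side i)⟩

theorem isTriangle (h : RealizesEdges Φ B) {E : Set (Set M)} {t : Tri}
    (hE : ∀ k, seg Φ B (t.edge k) ∈ E) :
    IsTriangle E (point Φ B (t.vertex 0)) (point Φ B (t.vertex 1)) (point Φ B (t.vertex 2))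
      (Φ ⁻¹' openCell (t.cell B)) := by
  refine ⟨fun h' => t.vertex_ne 0 (point_injective h'),
    fun h' => t.vertex_ne 1 (point_injective h'),
    fun h' => t.vertex_ne 2 (point_injective h'), ?_, _, hE 0, _, hE 1, _, hE 2,
    h.isSegment_of_joins (t.joins_edge 0), h.isSegment_of_joins (t.joins_edge 1),
    h.isSegment_of_joins (t.joins_edge 2), ?_⟩
  · rw [← Φ.preimage_closure, t.closure_openCell]
    exact t.isDisc_closedCell.preimage Φ
  · rw [← Φ.preimage_frontier, t.frontier_openCell]
    rfl

theorem point_mem_seg (h : RealizesEdges Φ B) (e : Edge) :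
    point Φ B e.fst ∈ seg Φ B e ∧ point Φ B e.snd ∈ seg Φ B e :=
  ⟨(h.isSegment e).1.left_mem, (h.isSegment e).1.right_mem⟩

/-- The faces of a family of edges that contain a point of one of the triangles. -/
theorem connectedComponentIn_eq {X N : Set M} {A : Set Edge} {t : Tri}
    (hX : Φ ⁻¹' openCell (t.cell B) ⊆ X) (hN : N ⊆ ⋃₀ (seg Φ B '' A))
    (hA : ∀ e ∈ A, ∀ x ∈ e.pts B, x ∉ openCell (t.cell B)) (ht : ∀ k, t.edge k ∈ A) {x : M}
    (hx : Φ x ∈ openCell (t.cell B)) :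
    connectedComponentIn (X \ (N ∪ ⋃₀ (seg Φ B '' A))) x = Φ ⁻¹' openCell (t.cell B) := by
  have hNA : N ∪ ⋃₀ (seg Φ B '' A) = ⋃₀ (seg Φ B '' A) := union_eq_right.2 hN
  rw [hNA]
  refine connectedComponentIn_eq_of_frontier (isOpen_openCell.preimage Φ.continuous)
    (Φ.isPreconnected_preimage.2 isPreconnected_openCell) ?_ ?_ hx
  · refine fun y hy => ⟨hX hy, ?_⟩
    rintro ⟨_, ⟨e, he, rfl⟩, hye⟩
    exact hA e he _ hye hy
  · intro y hy
    rw [← Φ.preimage_frontier, t.frontier_openCell] at hy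
    rintro ⟨-, hy'⟩
    rcases hy with (hy | hy) | hy
    · exact hy' ⟨_, ⟨_, ht 0, rfl⟩, hy⟩
    · exact hy' ⟨_, ⟨_, ht 1, rfl⟩, hy⟩
    · exact hy' ⟨_, ⟨_, ht 2, rfl⟩, hy⟩

/-- If the face that contains the centre is triangular, it is bounded by three diagonals. -/
theorem exists_diag_of_isTriangle (h : RealizesEdges Φ B) {X N : Set M} {A : Set Edge} {n : S2}
    (hn : (n : E3) = B 2)
    (hX : Φ.symm n ∈ X) (hN : ∀ i, point Φ B (some i) ∈ N) (hN' : N ⊆ range (point Φ B))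
    (hT : ∀ C ∈ faces X N (seg Φ B '' A), ∃ a b c, IsTriangle (seg Φ B '' A) a b c C) :
    ∃ i, diag i ∈ A ∧ diag (i + 2) ∈ A ∧ diag (i + 4) ∈ A := by
  have hnseg : ∀ e, Φ.symm n ∉ seg Φ B e := fun e he => by
    refine notMem_pts_of_coe_eq hn e ?_
    simpa [seg] using he
  have hmem : Φ.symm n ∈ X \ (N ∪ ⋃₀ (seg Φ B '' A)) := by
    refine ⟨hX, ?_⟩
    rintro (h1 | ⟨_, ⟨e, -, rfl⟩, h1⟩)
    -- The centre is not a node, since every node is the end of some edge and the centre is on none.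
    · obtain ⟨m, hm⟩ := hN' h1
      have hjoin : ∃ e : Edge, m = e.fst ∨ m = e.snd := by
        rcases m with _ | i
        · exact ⟨spoke 0, Or.inr rfl⟩
        · exact ⟨spoke i, Or.inl rfl⟩
      obtain ⟨e, rfl | rfl⟩ := hjoin
      · exact hnseg e (hm ▸ (h.point_mem_seg e).1)
      · exact hnseg e (hm ▸ (h.point_mem_seg e).2)
    · exact hnseg e h1
  set C := connectedComponentIn (X \ (N ∪ ⋃₀ (seg Φ B '' A))) (Φ.symm n) with hC
  obtain ⟨a, b, c, -, -, -, -, _, ⟨e₁, he₁, rfl⟩, _, ⟨e₂, he₂, rfl⟩, _, ⟨e₃, he₃, rfl⟩, s₁, s₂, s₃,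
    hfr⟩ := hT C ⟨_, hmem, rfl⟩
  obtain ⟨α, β, rfl, rfl, j₁⟩ := h.exists_joins_of_isSegment s₁
  obtain ⟨β', γ, hβ, rfl, j₂⟩ := h.exists_joins_of_isSegment s₂
  obtain rfl := point_injective hβ
  have j₃ := h.joins_of_isSegment s₃
  rcases joined_cycle α β γ j₁.joined j₂.joined j₃.joined with
    ⟨i, ⟨rfl, rfl, rfl⟩ | ⟨rfl, rfl, rfl⟩⟩ | ⟨k, a₁, a₂, a₃⟩
  · obtain rfl := j₁.eq (f := diag i) (Or.inl ⟨rfl, rfl⟩)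
    obtain rfl := j₂.eq (f := diag (i + 2)) (Or.inl ⟨rfl, by simp [snd, add_assoc]⟩)
    obtain rfl := j₃.eq (f := diag (i + 4)) (Or.inl ⟨rfl, by simp [snd, add_assoc]⟩)
    exact ⟨i, he₁, he₂, he₃⟩
  · obtain rfl := j₁.eq (f := diag (i + 2)) (Or.inr ⟨rfl, by simp [snd, add_assoc]⟩)
    obtain rfl := j₂.eq (f := diag i) (Or.inr ⟨rfl, by simp [snd]⟩)
    obtain rfl := j₃.eq (f := diag (i + 4)) (Or.inr ⟨rfl, by simp [snd, add_assoc]⟩)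
    exact ⟨i, he₂, he₁, he₃⟩
  · exfalso
    have hsymm : ∀ {a b}, avoids k a b = true → avoids k b a = true := by
      intro a b
      simp only [avoids, Bool.and_eq_true, Bool.not_eq_true', Bool.and_eq_false_iff,
        decide_eq_true_eq, decide_eq_false_iff_not, ne_eq]
      tauto
    have hav : ∀ {e : Edge} {a b}, e.Joins a b → avoids k a b = true →
        avoids k e.fst e.snd = true := by
      rintro e a b (⟨rfl, rfl⟩ | ⟨rfl, rfl⟩) hab
      · exact hab
      · exact hsymm hab
    -- The arc from the centre to vertex `k` leaves the face, because vertices are removed points.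
    -- It must meet one of the three bounding edges, but all of them avoid it.
    obtain ⟨z, hz, hz'⟩ := IsPreconnected.exists_mem_frontier (C := C)
      (Φ.isPreconnected_preimage.2 (isPreconnected_meridian (B := B) k)) (x := Φ.symm n)
      (y := point Φ B (some k)) (by simpa using mem_meridian_of_coe_eq hn k)
      (mem_connectedComponentIn hmem) (by simpa [point] using node_mem_meridian k)
      (fun hk => (connectedComponentIn_subset _ _ hk).2 (Or.inl (hN k)))
    rw [hfr] at hz'
    rcases hz' with (hz' | hz') | hz'
    · exact notMem_meridian (hav j₁ a₁) hz' hz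
    · exact notMem_meridian (hav j₂ a₂) hz' hz
    · exact notMem_meridian (hav j₃ a₃) hz' hz

end RealizesEdges

end Surface

end FlipGraph

/-! ### Classification of the triangulations, and the absence of flips -/

namespace FlipGraph

open Edge

section Surface

variable {M : Type*} [MetricSpace M] {Φ : M ≃ₜ S2} {B : OrthonormalBasis (Fin 3) ℝ E3}

/-- The three short diagonals of one of the two kinds. -/
def diagonals (Φ : M ≃ₜ S2) (B : OrthonormalBasis (Fin 3) ℝ E3) (o : Fin 6) : Set (Set M) :=
  seg Φ B '' {e | ∃ i, e = diag i ∧ SameParity o i}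

theorem not_crosses_of_mem_sphereEdges {o : Fin 6} {e f : Edge} (he : e ∈ sphereEdges o)
    (hf : f ∈ sphereEdges o) : ¬ Crosses e f := by
  rintro ⟨i, rfl, rfl⟩
  exact not_sameParity_add_one o i ⟨he, hf⟩

/-- A family of edges without crossings which contains the three diagonals of one kind contains no
further diagonal. -/
theorem subset_sphereEdges {A : Set Edge} (hA : ∀ e ∈ A, ∀ f ∈ A, ¬ Crosses e f) {o : Fin 6}
    (ho : ∀ i, SameParity o i → diag i ∈ A) : A ⊆ sphereEdges o := by
  rintro (i | i | i) hi
  · trivial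
  · by_contra hcon
    exact hA _ hi _ (ho _ (sameParity_add_one hcon)) ⟨i, rfl, rfl⟩
  · trivial

theorem exists_sameParity {A : Set Edge} {i : Fin 6} (h0 : diag i ∈ A) (h2 : diag (i + 2) ∈ A)
    (h4 : diag (i + 4) ∈ A) :
    (∀ j, SameParity 0 j → diag j ∈ A) ∨ ∀ j, SameParity 1 j → diag j ∈ A := by
  have key : ∀ o, SameParity o i → ∀ j, SameParity o j → diag j ∈ A := by
    intro o hi j hj
    rcases hi.eq_add hj with rfl | rfl | rfl
    · simpa using h0
    · exact h2
    · exact h4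
  exact (sameParity_or i).imp (key 0) (key 1)

namespace RealizesEdges

theorem sides_union_diagonals (h : RealizesEdges Φ B) (o : Fin 6) :
    sides (fun i => point Φ B (some i)) ∪ diagonals Φ B o = seg Φ B '' polygonEdges o := by
  rw [h.sides_eq, diagonals, ← image_union]
  congr 1
  ext e
  rcases e with i | i | i <;> simp [polygonEdges]

theorem isPolygon (h : RealizesEdges Φ B) :
    IsPolygon (fun i => point Φ B (some i)) (Φ ⁻¹' closedCell (hexagon B)) where
  three_le := by norm_num
  injective := point_injective.comp (Option.some_injective _)
  exists_side i := ⟨_, h.isSegment (side i)⟩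
  nonCrossing := by
    rw [h.sides_eq, h.nonCrossing_image_iff]
    rintro _ ⟨i, rfl⟩ f - ⟨j, hj, -⟩
    simp at hj
  isDisc := isDisc_hexagon.preimage Φ
  frontier_eq := by
    rw [← Φ.preimage_frontier, frontier_hexagon, h.sides_eq]
    ext x
    simp [seg]

theorem isPolygonTriangulation (h : RealizesEdges Φ B) (o : Fin 6) :
    IsPolygonTriangulation (fun i => point Φ B (some i)) (Φ ⁻¹' closedCell (hexagon B))
      (diagonals Φ B o) where
  admissible := by
    rintro _ ⟨_, ⟨i, rfl, -⟩, rfl⟩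
    refine ⟨i, i + 2, by simp, by simp, by simp [add_assoc], h.isSegment (diag i), ?_⟩
    exact preimage_mono (diag_subset_hexagon i)
  nonCrossing := by
    rw [h.sides_union_diagonals, h.nonCrossing_image_iff]
    exact fun e he f hf => not_crosses_of_mem_sphereEdges (polygonEdges_subset o he)
      (polygonEdges_subset o hf)
  triangular := by
    rw [h.sides_union_diagonals]
    rintro C ⟨x, ⟨hxR, hx⟩, rfl⟩
    obtain ⟨t, ht, hin, hxt⟩ := Tri.exists_inner_of_mem_hexagon o hxR fun e he hxe =>
      hx (Or.inr ⟨_, ⟨e, he, rfl⟩, hxe⟩)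
    have hedge := t.edge_mem_polygonEdges ht hin
    rw [connectedComponentIn_eq (preimage_mono (Tri.openCell_subset_hexagon hin)) ?_
      (fun e he y hy => Tri.notMem_openCell ht (polygonEdges_subset o he) hy) hedge hxt]
    · exact ⟨_, _, _, h.isTriangle fun k => ⟨_, hedge k, rfl⟩⟩
    · rintro _ ⟨i, rfl⟩
      exact ⟨_, ⟨side i, trivial, rfl⟩, (h.point_mem_seg (side i)).1⟩

/-- All admissible diagonals are short ones. The central face forces three of one parity, and each
diagonal of the other parity crosses one of these. -/
theorem eq_diagonals_of_isPolygonTriangulation (h : RealizesEdges Φ B) {T : Set (Set M)}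
    (hT : IsPolygonTriangulation (fun i => point Φ B (some i)) (Φ ⁻¹' closedCell (hexagon B)) T) :
    T = diagonals Φ B 0 ∨ T = diagonals Φ B 1 := by
  have hdiag : ∀ s ∈ T, ∃ i, s = seg Φ B (diag i) := by
    intro s hs
    obtain ⟨i, j, hij, h1, h2, h3, -⟩ := hT.admissible s hs
    obtain ⟨e, he, rfl⟩ := h.exists_eq_seg (fun h' => hij (Option.some_injective _ h')) h3
    rcases e with k | k | k
    · rcases he with ⟨p, q⟩ | ⟨p, q⟩ <;> simp only [fst, snd, Option.some.injEq] at p q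
      · exact absurd (by rw [← p, ← q]) h1
      · exact absurd (by rw [← p, ← q]) h2
    · exact ⟨k, rfl⟩
    · rcases he with ⟨p, q⟩ | ⟨p, q⟩ <;> simp [snd] at q
  set A : Set Edge := {e | seg Φ B e ∈ sides (fun i => point Φ B (some i)) ∪ T} with hA
  have hEA : sides (fun i => point Φ B (some i)) ∪ T = seg Φ B '' A := by
    refine Subset.antisymm (fun s hs => ?_) ?_
    · have : ∃ e, s = seg Φ B e := by
        rcases hs with hs' | hs'
        · rw [h.sides_eq] at hs'
          obtain ⟨e, -, rfl⟩ := hs'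
          exact ⟨e, rfl⟩
        · obtain ⟨i, rfl⟩ := hdiag s hs'
          exact ⟨_, rfl⟩
      obtain ⟨e, rfl⟩ := this
      exact ⟨e, hs, rfl⟩
    · rintro _ ⟨e, he, rfl⟩
      exact he
  have hmemT : ∀ i, diag i ∈ A → seg Φ B (diag i) ∈ T := by
    rintro i (hi | hi)
    · rw [h.sides_eq] at hi
      obtain ⟨_, ⟨j, rfl⟩, hj⟩ := hi
      simpa using h.seg_injective hj
    · exact hi
  have hnc := hT.nonCrossing
  have htri := hT.triangular
  rw [hEA] at hnc htri
  rw [h.nonCrossing_image_iff] at hnc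
  have hn : ((⟨B 2, by simp⟩ : S2) : E3) = B 2 := rfl
  obtain ⟨i, i0, i2, i4⟩ := h.exists_diag_of_isTriangle hn
    (by simpa using openCell_subset_closedCell (mem_openCell_hexagon_of_coe_eq hn))
    (fun i => mem_range_self i) (by rintro _ ⟨i, rfl⟩; exact mem_range_self _) htri
  have key : ∀ o, (∀ j, SameParity o j → diag j ∈ A) → T = diagonals Φ B o := by
    intro o ho
    refine Subset.antisymm (fun s hs => ?_) ?_
    · obtain ⟨j, rfl⟩ := hdiag s hs
      have hj : diag j ∈ A := Or.inr hs
      exact ⟨_, ⟨j, rfl, subset_sphereEdges hnc ho hj⟩, rfl⟩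
    · rintro _ ⟨_, ⟨j, rfl, hj⟩, rfl⟩
      exact hmemT j (ho j hj)
  exact (exists_sameParity i0 i2 i4).imp (key 0) (key 1)

/-- A node on `e` that is not seen to be an end of `e` also lies on a spoke other than `e`. Spokes
cross nothing, so it is a common end. -/
theorem seg_inter_range (h : RealizesEdges Φ B) (e : Edge) :
    seg Φ B e ∩ range (point Φ B) = {point Φ B e.fst, point Φ B e.snd} := by
  refine Subset.antisymm ?_ ?_
  · rintro _ ⟨hx, ⟨m, rfl⟩⟩
    have hspoke : ∃ i, m = (spoke i).fst ∨ (m = (spoke i).snd ∧ ∀ j, e ≠ spoke j) ∨ m = e.snd := by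
      rcases m with _ | i
      · rcases e with j | j | j
        · exact ⟨0, Or.inr (Or.inl ⟨rfl, by simp⟩)⟩
        · exact ⟨0, Or.inr (Or.inl ⟨rfl, by simp⟩)⟩
        · exact ⟨0, Or.inr (Or.inr rfl)⟩
      · exact ⟨i, Or.inl rfl⟩
    have key : ∀ i, (m = (spoke i).fst ∨ m = (spoke i).snd) → e ≠ spoke i →
        m = e.fst ∨ m = e.snd := by
      intro i hm hne
      have hm' : node B m ∈ (spoke i).pts B := by
        have := h.point_mem_seg (spoke i)
        rcases hm with rfl | rfl
        · simpa [seg, apply_point] using this.1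
        · simpa [seg, apply_point] using this.2
      have hx' : node B m ∈ e.pts B := by simpa [seg, apply_point] using hx
      obtain ⟨m', h1, h2, h3⟩ := exists_common_node hne (by rintro ⟨j, -, hj⟩; simp at hj)
        (by rintro ⟨j, hj, -⟩; simp at hj) hx' hm'
      rwa [node_injective h3]
    have hm : m = e.fst ∨ m = e.snd := by
      obtain ⟨i, hi | ⟨hi, hne⟩ | hi⟩ := hspoke
      · by_cases hne : e = spoke i
        · exact Or.inl (hne ▸ hi)
        · exact key i (Or.inl hi) hne
      · exact key i (Or.inr hi) (hne i)
      · exact Or.inr hi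
    rcases hm with rfl | rfl <;> simp
  · rintro x (rfl | rfl)
    · exact ⟨(h.point_mem_seg e).1, mem_range_self _⟩
    · exact ⟨(h.point_mem_seg e).2, mem_range_self _⟩

theorem isSegmentSystem_image_iff (h : RealizesEdges Φ B) {A : Set Edge} :
    IsSegmentSystem (range (point Φ B)) (seg Φ B '' A) ↔ ∀ e ∈ A, ∀ f ∈ A, ¬ Crosses e f := by
  rw [← h.nonCrossing_image_iff]
  refine ⟨fun hA => hA.2, fun hA => ⟨?_, hA⟩⟩
  rintro _ ⟨e, -, rfl⟩
  refine ⟨_, mem_range_self e.fst, _, mem_range_self e.snd, fun h' => ?_, h.isSegment e,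
    h.seg_inter_range e⟩
  have := point_injective h'
  rcases e with i | i | i <;> simp [fst, snd] at this

theorem exists_eq_image (h : RealizesEdges Φ B) {T : Set (Set M)}
    (hT : IsSegmentSystem (range (point Φ B)) T) : ∃ A, T = seg Φ B '' A := by
  refine ⟨{e | seg Φ B e ∈ T}, Subset.antisymm (fun s hs => ?_) ?_⟩
  · obtain ⟨_, ⟨a, rfl⟩, _, ⟨b, rfl⟩, hab, hseg, -⟩ := hT.1 s hs
    obtain ⟨e, -, rfl⟩ := h.exists_eq_seg (fun h' => hab (congrArg _ h')) hseg
    exact ⟨e, hs, rfl⟩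
  · rintro _ ⟨e, he, rfl⟩
    exact he

theorem maximal_sphereEdges (h : RealizesEdges Φ B) (o : Fin 6) :
    Maximal (IsSegmentSystem (range (point Φ B))) (seg Φ B '' sphereEdges o) := by
  refine ⟨h.isSegmentSystem_image_iff.2 fun e he f hf => not_crosses_of_mem_sphereEdges he hf, ?_⟩
  intro T hT hle
  obtain ⟨A, rfl⟩ := h.exists_eq_image hT
  rw [h.isSegmentSystem_image_iff] at hT
  refine image_mono (subset_sphereEdges hT fun i hi => ?_)
  obtain ⟨e, he, he'⟩ := hle ⟨diag i, hi, rfl⟩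
  rwa [← h.seg_injective he']

theorem isPointSetTriangulation (h : RealizesEdges Φ B) (o : Fin 6) :
    IsPointSetTriangulation (range (point Φ B)) (seg Φ B '' sphereEdges o) where
  maximal := h.maximal_sphereEdges o
  triangular := by
    rintro C ⟨x, ⟨-, hx⟩, rfl⟩ -
    obtain ⟨t, ht, hxt⟩ := Tri.exists_of_sphere (B := B) o (x := Φ x) fun e he hxe =>
      hx (Or.inr ⟨_, ⟨e, he, rfl⟩, hxe⟩)
    have hedge := Tri.edge_mem_sphereEdges ht
    rw [connectedComponentIn_eq (subset_univ _) ?_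
      (fun e he y hy => Tri.notMem_openCell ht he hy) hedge hxt]
    · exact ⟨_, _, _, h.isTriangle fun k => ⟨_, hedge k, rfl⟩⟩
    · rintro _ ⟨_ | i, rfl⟩
      · exact ⟨_, ⟨spoke 0, trivial, rfl⟩, (h.point_mem_seg (spoke 0)).2⟩
      · exact ⟨_, ⟨spoke i, trivial, rfl⟩, (h.point_mem_seg (spoke i)).1⟩

theorem eq_of_isPointSetTriangulation (h : RealizesEdges Φ B) {T : Set (Set M)}
    (hT : IsPointSetTriangulation (range (point Φ B)) T) :
    T = seg Φ B '' sphereEdges 0 ∨ T = seg Φ B '' sphereEdges 1 := by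
  obtain ⟨A, rfl⟩ := h.exists_eq_image hT.maximal.prop
  have hnc := h.isSegmentSystem_image_iff.1 hT.maximal.prop
  -- Sides and spokes cross nothing, so a maximal system contains them.
  have hfree : ∀ e : Edge, (∀ i, e ≠ diag i) → e ∈ A := by
    intro e he
    have : seg Φ B e ∈ seg Φ B '' A := by
      refine hT.maximal.mem_of_prop_insert ?_
      rw [← image_insert_eq, h.isSegmentSystem_image_iff]
      rintro f (rfl | hf) g (rfl | hg)
      · rintro ⟨i, hi, -⟩; exact he i hi
      · rintro ⟨i, hi, -⟩; exact he i hi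
      · rintro ⟨i, -, hi⟩; exact he _ hi
      · exact hnc f hf g hg
    obtain ⟨f, hf, hfe⟩ := this
    rwa [← h.seg_injective hfe]
  -- On a compact surface every face is bounded, so the central face is triangular.
  have : CompactSpace M := Φ.symm.compactSpace
  have hn : ((⟨B 2, by simp⟩ : S2) : E3) = B 2 := rfl
  obtain ⟨i, i0, i2, i4⟩ := h.exists_diag_of_isTriangle hn (mem_univ _)
    (fun i => mem_range_self _) subset_rfl
    (fun C hC => hT.triangular C hC (Metric.isBounded_of_compactSpace))
  have key : ∀ o, (∀ j, SameParity o j → diag j ∈ A) → A = sphereEdges o := by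
    intro o ho
    refine Subset.antisymm (subset_sphereEdges hnc ho) ?_
    rintro (i | i | i) hi
    · exact hfree _ (by simp)
    · exact ho i hi
    · exact hfree _ (by simp)
  exact (exists_sameParity i0 i2 i4).imp (fun h' => by rw [key 0 h']) (fun h' => by rw [key 1 h'])

end RealizesEdges

/-- If exactly two sets of edges have the property `P`, and each of them contains two edges that
do not belong to the other one, then the graph of these sets whose edges are flips has two nodes
and no edges. -/
theorem card_and_flipGraph_eq_bot {P : Set (Set M) → Prop} {T₀ T₁ : Set (Set M)}
    (hP : ∀ T, P T ↔ T = T₀ ∨ T = T₁)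
    (h₀ : ∃ s ∈ T₀, ∃ t ∈ T₀, s ≠ t ∧ s ∉ T₁ ∧ t ∉ T₁)
    (h₁ : ∃ s ∈ T₁, ∃ t ∈ T₁, s ≠ t ∧ s ∉ T₀ ∧ t ∉ T₀) (X S : Set M) (E : Set (Set M)) :
    Nat.card {T // P T} = 2 ∧
      SimpleGraph.fromRel (fun T T' : {T // P T} => IsFlip X S E T.1 T'.1) = ⊥ ∧
      ¬ (SimpleGraph.fromRel (fun T T' : {T // P T} => IsFlip X S E T.1 T'.1)).Preconnected := by
  -- A flip removes a single edge, so two edges cannot both disappear.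
  have hflip : ∀ {T T' : Set (Set M)}, (∃ s ∈ T, ∃ t ∈ T, s ≠ t ∧ s ∉ T' ∧ t ∉ T') →
      ¬ IsFlip X S E T T' := by
    rintro T T' ⟨s, hs, t, ht, hst, hs', ht'⟩ ⟨a, b, c, d, e, f, C, D, -, -, -, -, -, -, -, -, -,
      -, rfl⟩
    have h1 : s = e := by
      by_contra h
      exact hs' (Or.inr ⟨hs, h⟩)
    have h2 : t = e := by
      by_contra h
      exact ht' (Or.inr ⟨ht, h⟩)
    exact hst (h1.trans h2.symm)
  have hne : T₀ ≠ T₁ := by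
    rintro rfl
    obtain ⟨s, hs, -, -, -, hs', -⟩ := h₀
    exact hs' hs
  have hbot : SimpleGraph.fromRel (fun T T' : {T // P T} => IsFlip X S E T.1 T'.1) = ⊥ := by
    rw [eq_bot_iff]
    rintro ⟨T, hT⟩ ⟨T', hT'⟩ ⟨hTT', hadj⟩
    have hTT : T ≠ T' := fun h => hTT' (Subtype.ext h)
    rcases (hP T).1 hT with rfl | rfl <;> rcases (hP T').1 hT' with rfl | rfl
    · exact absurd rfl hTT
    · rcases hadj with h | h
      · exact (hflip h₀ h).elim
      · exact (hflip h₁ h).elim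
    · rcases hadj with h | h
      · exact (hflip h₁ h).elim
      · exact (hflip h₀ h).elim
    · exact absurd rfl hTT
  refine ⟨?_, hbot, ?_⟩
  · have : {T | P T} = {T₀, T₁} := by ext T; simp [hP]
    have hc : Nat.card {T // P T} = Set.ncard {T | P T} := rfl
    rw [hc, this, Set.ncard_pair hne]
  · rw [hbot]
    intro hpre
    have := hpre ⟨T₀, (hP _).2 (Or.inl rfl)⟩ ⟨T₁, (hP _).2 (Or.inr rfl)⟩
    rw [SimpleGraph.reachable_bot] at this
    exact hne (congrArg Subtype.val this)

namespace RealizesEdges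

theorem exists_two_diagonals (h : RealizesEdges Φ B) {A A' : Set Edge} {o o' : Fin 6}
    (hA : ∀ i, SameParity o i → diag i ∈ A) (hA' : ∀ i, diag i ∈ A' → SameParity o' i)
    (ho : ∀ i, ¬ (SameParity o i ∧ SameParity o' i)) :
    ∃ s ∈ seg Φ B '' A, ∃ t ∈ seg Φ B '' A, s ≠ t ∧ s ∉ seg Φ B '' A' ∧ t ∉ seg Φ B '' A' := by
  have hn : ∀ i, SameParity o i → seg Φ B (diag i) ∉ seg Φ B '' A' := by
    rintro i hi ⟨e, he, hei⟩
    rw [h.seg_injective hei] at he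
    exact ho i ⟨hi, hA' i he⟩
  have h0 : SameParity o o := Or.inl rfl
  refine ⟨_, ⟨_, hA _ h0, rfl⟩, _, ⟨_, hA _ h0.add_two, rfl⟩, fun hst => ?_, hn _ h0,
    hn _ h0.add_two⟩
  simpa using h.seg_injective hst

/-- The hexagon has exactly two triangulations, and no flip leads from one to the other. -/
theorem polygonTG_eq_bot (h : RealizesEdges Φ B) {v : Fin 6 → M}
    (hv : v = fun i => point Φ B (some i)) :
    Nat.card {T // IsPolygonTriangulation v (Φ ⁻¹' closedCell (hexagon B)) T} = 2 ∧
      polygonTG v (Φ ⁻¹' closedCell (hexagon B)) = ⊥ ∧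
      ¬ (polygonTG v (Φ ⁻¹' closedCell (hexagon B))).Preconnected := by
  subst hv
  refine card_and_flipGraph_eq_bot (T₀ := diagonals Φ B 0) (T₁ := diagonals Φ B 1)
    (fun T => ⟨h.eq_diagonals_of_isPolygonTriangulation, ?_⟩) ?_ ?_ _ _ _
  · rintro (rfl | rfl) <;> exact h.isPolygonTriangulation _
  · exact h.exists_two_diagonals (fun i hi => ⟨i, rfl, hi⟩)
      (by rintro i ⟨j, hj, hij⟩; simp only [diag.injEq] at hj; exact hj ▸ hij) not_sameParity_and
  · exact h.exists_two_diagonals (fun i hi => ⟨i, rfl, hi⟩)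
      (by rintro i ⟨j, hj, hij⟩; simp only [diag.injEq] at hj; exact hj ▸ hij)
      fun i hi => not_sameParity_and i hi.symm

/-- The vertices of the hexagon together with the pole below it have exactly two triangulations,
and no flip leads from one to the other. -/
theorem pointSetTG_eq_bot (h : RealizesEdges Φ B) {S : Set M} (hS : S = range (point Φ B)) :
    Nat.card {T // IsPointSetTriangulation S T} = 2 ∧ pointSetTG S = ⊥ ∧
      ¬ (pointSetTG S).Preconnected := by
  subst hS
  refine card_and_flipGraph_eq_bot (T₀ := seg Φ B '' sphereEdges 0)
    (T₁ := seg Φ B '' sphereEdges 1) (fun T => ⟨h.eq_of_isPointSetTriangulation, ?_⟩) ?_ ?_ _ _ _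
  · rintro (rfl | rfl) <;> exact h.isPointSetTriangulation _
  · exact h.exists_two_diagonals (fun i hi => hi) (fun i hi => hi) not_sameParity_and
  · exact h.exists_two_diagonals (fun i hi => hi) (fun i hi => hi)
      fun i hi => not_sameParity_and i hi.symm

end RealizesEdges

end Surface

end FlipGraph

/-! ### The bump, and why opposite vertices define no segment -/

namespace FlipGraph

open Edge InnerProductGeometry

variable {B : OrthonormalBasis (Fin 3) ℝ E3}

theorem exists_orthonormalBasis (n : S2) : ∃ B : OrthonormalBasis (Fin 3) ℝ E3, B 2 = n := by
  have ho : Orthonormal ℝ (({2} : Set (Fin 3)).domRestrict fun _ => (n : E3)) := by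
    constructor
    · exact fun _ => norm_eq_of_mem_sphere n
    · intro i j hij
      exact absurd (Subsingleton.elim i j) hij
  obtain ⟨B, hB⟩ := ho.exists_orthonormalBasis_extension_of_card_eq (by simp)
  exact ⟨B, hB 2 rfl⟩

theorem norm_vertexVec_sq_le (i : Fin 6) : ‖vertexVec B i‖ ^ 2 ≤ 3 / 2 := by
  rw [← real_inner_self_eq_norm_sq]
  fin_cases i <;>
    simp [vertexVec, -inner_self_eq_norm_sq_to_K, inner_add_left,
      inner_add_right, inner_sub_left, inner_sub_right, real_inner_smul_left,
      real_inner_smul_right, B.inner_eq_ite] <;> norm_num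

/-- The cosine is the inverse of the norm of the vertex vector, whose square is at most `3 / 2 < 2`.
The bound `π / 4` makes sides shorter than `π / 2` and the way from a vertex to the lower pole
longer than `3π / 4`. -/
theorem angle_node_lt (i : Fin 6) : angle (node B (some i) : E3) (B 2) < Real.pi / 4 := by
  by_contra! hle
  have h1 := Real.cos_le_cos_of_nonneg_of_le_pi (by positivity) (angle_le_pi _ _) hle
  have h2 := inner_eq_cos_angle_of_norm_eq_one (norm_eq_of_mem_sphere (node B (some i)))
    (B.norm_eq_one 2)
  have hn : 0 < ‖vertexVec B i‖ := norm_pos_iff.2 (nodeVec_ne_zero B (some i))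
  have h3 : inner ℝ (node B (some i) : E3) (B 2) = ‖vertexVec B i‖⁻¹ := by
    rw [real_inner_comm]
    change height B (node B (some i)) = _
    simp [node, toSphere, nodeVec, height_vertexVec]
  rw [← h2, h3, Real.cos_pi_div_four] at h1
  have h4 := norm_vertexVec_sq_le (B := B) i
  have h5 : ‖vertexVec B i‖⁻¹ * ‖vertexVec B i‖ = 1 := inv_mul_cancel₀ hn.ne'
  have h6 : 1 ≤ Real.sqrt 2 / 2 * ‖vertexVec B i‖ := by
    rw [← h5]; gcongr
  have h7 : (Real.sqrt 2 / 2 * ‖vertexVec B i‖) ^ 2 = ‖vertexVec B i‖ ^ 2 / 2 := by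
    rw [mul_pow, div_pow, Real.sq_sqrt (by norm_num)]; ring
  nlinarith

theorem coe_node_none : (node B none : E3) = -B 2 := by
  simp [node, toSphere, nodeVec]

theorem angle_node_lt_pi (e : Edge) : angle (node B e.fst : E3) (node B e.snd) < Real.pi := by
  refine (angle_le_pi _ _).lt_of_ne fun h => ?_
  obtain ⟨-, r, hr, he⟩ := angle_eq_pi_iff.1 h
  have hh : ∀ i j : Fin 6, (node B (some j) : E3) ≠ r • (node B (some i) : E3) := by
    intro i j hij
    have h1 := (height_node (B := B) i).1
    have h2 := (height_node (B := B) j).1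
    rw [hij, map_smul, smul_eq_mul] at h2
    nlinarith
  rcases e with i | i | i
  · exact hh _ _ he
  · exact hh _ _ he
  · simp only [snd, fst, coe_node_none] at he
    have h1 := height_node (B := B) i
    have h2 := congrArg (horizontal B i) he
    rw [map_neg, horizontal_basis_two, map_smul, smul_eq_mul, h1.2.1, neg_zero, eq_comm,
      mul_eq_zero] at h2
    rcases h2 with h2 | h2 <;> linarith [h1.1]

/-- A rotationally symmetric height function around the axis `B 2`. -/
noncomputable def bump (B : OrthonormalBasis (Fin 3) ℝ E3) (ε : ℝ) : Height where
  -- The summit has height `11`, so reaching it from a vertex costs at least `10`, more than `3π /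
  -- 2`.
  toFun x := 1 + 10 * Real.smoothTransition (1 - ‖x - B 2‖ ^ 2 / ε ^ 2)
  contDiff := by
    refine contDiff_const.add (contDiff_const.mul (Real.smoothTransition.contDiff.comp ?_))
    exact contDiff_const.sub (((contDiff_id.sub contDiff_const).norm_sq ℝ).div_const _)
  one_le x := by linarith [Real.smoothTransition.nonneg (1 - ‖x - B 2‖ ^ 2 / ε ^ 2)]

theorem bump_apply_basis (ε : ℝ) : (bump B ε).toFun (B 2) = 11 := by
  simp [bump]
  norm_num

theorem bump_eq_one {ε : ℝ} (hε : 0 < ε) {x : E3} (hx : ε ≤ ‖x - B 2‖) :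
    (bump B ε).toFun x = 1 := by
  have : 1 - ‖x - B 2‖ ^ 2 / ε ^ 2 ≤ 0 := by
    rw [sub_nonpos, one_le_div (by positivity)]
    gcongr
  simp [bump, Real.smoothTransition.zero_of_nonpos this]

theorem bump_map (ε : ℝ) {g : E3 ≃ₗᵢ[ℝ] E3} (hg : g (B 2) = B 2) (x : E3) :
    (bump B ε).toFun (g x) = (bump B ε).toFun x := by
  have : ‖g x - B 2‖ = ‖x - B 2‖ := by
    conv_lhs => rw [← hg, ← map_sub, g.norm_map]
  simp [bump, this]

section Opposite

variable {ε : ℝ}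

open Raised

theorem base_point (h : Height) (m : Option (Fin 6)) :
    (point (homeo h) B m).base = node B m := rfl

theorem isSegment_and_dist_eq (hε : 0 < ε) (hB : ∀ e : Edge, ∀ x ∈ e.pts B, ε ≤ ‖(x : E3) - B 2‖)
    (e : Edge) :
    IsSegment (point (homeo (bump B ε)) B e.fst) (point (homeo (bump B ε)) B e.snd)
      (seg (homeo (bump B ε)) B e) ∧
    dist (point (homeo (bump B ε)) B e.fst) (point (homeo (bump B ε)) B e.snd) =
      angle (node B e.fst : E3) (node B e.snd) := by
  rw [seg, e.pts_eq_arc]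
  refine isSegment_of_height_eq_one (angle_node_lt_pi e) fun z hz => ?_
  rw [base_point, base_point, ← e.pts_eq_arc] at hz
  exact bump_eq_one hε (hB e z hz)

theorem dist_side_lt (hε : 0 < ε) (hB : ∀ e : Edge, ∀ x ∈ e.pts B, ε ≤ ‖(x : E3) - B 2‖)
    (i : Fin 6) :
    dist (point (homeo (bump B ε)) B (some i)) (point (homeo (bump B ε)) B (some (i + 1))) <
      Real.pi / 2 := by
  have h := (isSegment_and_dist_eq hε hB (side i)).2
  simp only [fst, snd] at h
  rw [h]
  have h1 := angle_node_lt (B := B) i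
  have h2 := angle_node_lt (B := B) (i + 1)
  have h3 := angle_le_angle_add_angle (node B (some i) : E3) (B 2) (node B (some (i + 1)))
  rw [angle_comm (B 2)] at h3
  linarith

/-- Walk along three successive sides. -/
theorem dist_opposite_lt (hε : 0 < ε) (hB : ∀ e : Edge, ∀ x ∈ e.pts B, ε ≤ ‖(x : E3) - B 2‖)
    (i : Fin 6) :
    dist (point (homeo (bump B ε)) B (some i)) (point (homeo (bump B ε)) B (some (i + 3))) <
      3 * (Real.pi / 2) := by
  have h1 := dist_side_lt hε hB i
  have h2 := dist_side_lt hε hB (i + 1)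
  have h3 := dist_side_lt hε hB (i + 2)
  simp only [add_assoc, Fin.reduceAdd] at h2 h3
  have h4 := dist_triangle4 (point (homeo (bump B ε)) B (some i))
    (point (homeo (bump B ε)) B (some (i + 1))) (point (homeo (bump B ε)) B (some (i + 2)))
    (point (homeo (bump B ε)) B (some (i + 3)))
  linarith

/-- Opposite vertices do not define a segment: by symmetry, it would pass over the centre or
through the pole below it, and both ways are too long. -/
theorem not_isSegment_opposite (hε : 0 < ε)
    (hB : ∀ e : Edge, ∀ x ∈ e.pts B, ε ≤ ‖(x : E3) - B 2‖) (i : Fin 6)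
    (s : Set (Raised (bump B ε))) :
    ¬ IsSegment (point (homeo (bump B ε)) B (some i)) (point (homeo (bump B ε)) B (some (i + 3)))
      s := by
  intro hs
  have hlt := dist_opposite_lt hε hB i
  set p := point (homeo (bump B ε)) B (some i) with hp
  set q := point (homeo (bump B ε)) B (some (i + 3)) with hq
  have pb : p.base = node B (some i) := rfl
  have qb : q.base = node B (some (i + 3)) := rfl
  obtain ⟨p1, p2, p3⟩ := height_node (B := B) i
  obtain ⟨q1, q2, q3⟩ := height_node (B := B) (i + 3)
  rw [← pb] at p1 p2 p3
  rw [← qb] at q1 q2 q3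
  simp only [add_assoc, Fin.reduceAdd, horizontal_add_three, horizontal_add_five] at q2 q3
  -- The mirror plane contains the axis and both vertices. The reflection need not preserve the
  -- hexagon; it only has to preserve the bump.
  set g : E3 ≃ₗᵢ[ℝ] E3 := (ℝ ∙ horizontalVec B (i + 2))ᗮ.reflection with hg
  have gfix : ∀ x, g x = x ↔ horizontal B (i + 2) x = 0 := fun x => by
    rw [hg, Submodule.reflection_eq_self_iff, Submodule.mem_orthogonal_singleton_iff_inner_right]
    rfl
  have hρ := bump_map ε ((gfix (B 2)).2 (horizontal_basis_two B _))
  have hmapfix : ∀ x : Raised (bump B ε), map g x = x ↔ horizontal B (i + 2) x.base = 0 :=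
    fun x => by
      rw [← gfix]
      exact ⟨fun h => congrArg (fun y : Raised (bump B ε) => (y.base : E3)) h,
        fun h => Subtype.ext h⟩
  have hplane : ∀ x ∈ s, horizontal B (i + 2) x.base = 0 := fun x hx =>
    (hmapfix x).1 (hs.map_eq_self (dist_map hρ) ((hmapfix p).2 p3)
      ((hmapfix q).2 (by linarith)) hx)
  obtain ⟨γ, h0, h1, hγ, rfl⟩ := hs.1
  have hcont : ContinuousOn γ (Icc 0 (dist p q)) := by
    refine LipschitzOnWith.continuousOn (K := 1)
      (LipschitzOnWith.of_dist_le_mul fun t ht u hu => ?_)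
    rw [hγ t ht u hu, NNReal.coe_one, one_mul, Real.dist_eq]
  have hcont' : ContinuousOn (fun t => horizontal B i (γ t).base) (Icc 0 (dist p q)) :=
    ((horizontal B i).continuous.comp
      (continuous_subtype_val.comp (homeo (bump B ε)).continuous)).comp_continuousOn hcont
  -- Within the mirror plane, `horizontal B i` changes sign between the two vertices, and where it
  -- vanishes the geodesic is on the axis.
  have hivt := intermediate_value_Icc' dist_nonneg hcont'
  rw [h0, h1] at hivt
  obtain ⟨t, ht, hzero⟩ := hivt (a := 0) ⟨by linarith, by linarith⟩
  simp only at hzero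
  have hz2 := hplane _ ⟨t, ht, rfl⟩
  have d0 : dist p (γ t) = t := by
    have := hγ 0 ⟨le_rfl, dist_nonneg⟩ t ht
    rwa [h0, zero_sub, abs_neg, abs_of_nonneg ht.1] at this
  have d1 : dist (γ t) q = dist p q - t := by
    have := hγ t ht _ ⟨dist_nonneg, le_rfl⟩
    rwa [h1, abs_sub_comm, abs_of_nonneg (sub_nonneg.2 ht.2)] at this
  rcases le_total (height B (γ t).base) 0 with hle | hle
  -- Through the lower pole each part is longer than `3π / 4`, against a total below `3π / 2`.
  · have hb := eq_node_none i hzero hz2 hle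
    have a0 := angle_le_dist p (γ t)
    have a1 := angle_le_dist (γ t) q
    rw [hb, coe_node_none, angle_neg_right, pb] at a0
    rw [hb, coe_node_none, angle_neg_left, qb, angle_comm] at a1
    have b0 := angle_node_lt (B := B) i
    have b1 := angle_node_lt (B := B) (i + 3)
    linarith
  · have hB2 : B 2 ≠ 0 := ne_zero_of_apply_ne_zero (φ := height B) (by simp [height_basis_two])
    have hb : (γ t).base = toSphere (B 2) hB2 := by
      refine eq_toSphere hB2 hle ?_
      apply eq_of_coordinates (B := B) i <;>
        simp [hzero, hz2, horizontal_basis_two, height_basis_two]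
    have hb' : ((γ t).base : E3) = B 2 := by rw [hb]; simp [toSphere]
    have hemb : (γ t).emb = (11 : ℝ) • B 2 := by rw [emb, raise, hb', bump_apply_basis]
    -- Over the summit, the chord from height `1` to height `11` is already too long.
    have pemb : p.emb = node B (some i) := by
      rw [emb_eq_of_height_eq_one, pb]
      rw [pb]
      refine bump_eq_one hε (hB (side i) _ ?_)
      have hd := (isSegment_and_dist_eq hε hB (side i)).1.1.left_mem
      exact hd
    have hd := dist_emb_le p (γ t)
    rw [hemb, pemb, dist_comm, dist_eq_norm] at hd
    have h2 := norm_sub_norm_le ((11 : ℝ) • B 2) (node B (some i) : E3)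
    rw [norm_smul, B.norm_eq_one, norm_eq_of_mem_sphere, Real.norm_eq_abs] at h2
    norm_num at h2
    have := Real.pi_lt_d2
    linarith [ht.2]

theorem realizesEdges_bump (hε : 0 < ε)
    (hB : ∀ e : Edge, ∀ x ∈ e.pts B, ε ≤ ‖(x : E3) - B 2‖) :
    RealizesEdges (homeo (bump B ε)) B :=
  ⟨fun e => (isSegment_and_dist_eq hε hB e).1, not_isSegment_opposite hε hB⟩

end Opposite

variable (B) in
/-- The edges keep away from the centre. -/
theorem exists_pos_le_norm_sub : ∃ ε > 0, ∀ e : Edge, ∀ x ∈ e.pts B, ε ≤ ‖(x : E3) - B 2‖ := by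
  have key : ∀ e : Edge, ∃ ε > 0, ∀ x ∈ e.pts B, ε ≤ ‖(x : E3) - B 2‖ := by
    intro e
    have hopen : (e.pts B)ᶜ ∈ 𝓝 (⟨B 2, by simp⟩ : S2) :=
      e.isClosed_pts.isOpen_compl.mem_nhds (notMem_pts_of_coe_eq rfl e)
    obtain ⟨ε, hε, hball⟩ := Metric.mem_nhds_iff.1 hopen
    refine ⟨ε, hε, fun x hx => ?_⟩
    by_contra! hlt
    refine hball (?_ : x ∈ Metric.ball _ _) hx
    rw [Metric.mem_ball, Subtype.dist_eq, dist_eq_norm]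
    exact hlt
  choose ε hε h using key
  obtain ⟨i₁, h₁⟩ := Finite.exists_min fun i => ε (side i)
  obtain ⟨i₂, h₂⟩ := Finite.exists_min fun i => ε (diag i)
  obtain ⟨i₃, h₃⟩ := Finite.exists_min fun i => ε (spoke i)
  refine ⟨min (ε (side i₁)) (min (ε (diag i₂)) (ε (spoke i₃))),
    lt_min (hε _) (lt_min (hε _) (hε _)), ?_⟩
  rintro (i | i | i) x hx
  · exact (min_le_left _ _).trans ((h₁ i).trans (h _ x hx))
  · exact ((min_le_right _ _).trans (min_le_left _ _)).trans ((h₂ i).trans (h _ x hx))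
  · exact ((min_le_right _ _).trans (min_le_right _ _)).trans ((h₃ i).trans (h _ x hx))

end FlipGraph

theorem lemma3p1 (n : S2) (U : Set E3) (hU : U ∈ 𝓝 (n : E3)) :
    ∃ ρ : E3 → ℝ, IsBump n U ρ ∧
      ∃ (M : Type) (_ : MetricSpace M) (Φ : M ≃ₜ S2),
        (∀ x y : M, edist x y =
          intrinsicEDist (range (raise ρ)) (raise ρ (Φ x)) (raise ρ (Φ y))) ∧
        ∃ (v : Fin 6 → M) (R : Set M),
          IsPolygon v R ∧
          (∀ x ∈ R, 0 < inner ℝ (n : E3) (Φ x : E3)) ∧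
          Nat.card {T : Set (Set M) // IsPolygonTriangulation v R T} = 2 ∧
          polygonTG v R = ⊥ ∧
          ¬ (polygonTG v R).Preconnected ∧
          Nat.card {T : Set (Set M) //
            IsPointSetTriangulation (insert (Φ.symm (-n)) (range v)) T} = 2 ∧
          pointSetTG (insert (Φ.symm (-n)) (range v)) = ⊥ ∧
          ¬ (pointSetTG (insert (Φ.symm (-n)) (range v))).Preconnected := by
  obtain ⟨B, hBn⟩ := exists_orthonormalBasis n
  obtain ⟨ε₁, hε₁, hB⟩ := exists_pos_le_norm_sub B
  obtain ⟨ε₂, hε₂, hU'⟩ := Metric.mem_nhds_iff.1 hU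
  -- The first bound keeps the bump off the edges, the second keeps it inside `U`.
  set ε := min ε₁ ε₂
  have hε : 0 < ε := lt_min hε₁ hε₂
  have hr : RealizesEdges (Raised.homeo (bump B ε)) B :=
    realizesEdges_bump hε fun e x hx => (min_le_left _ _).trans (hB e x hx)
  refine ⟨(bump B ε).toFun, ⟨(bump B ε).contDiff, (bump B ε).one_le, ?_, fun x hx => ?_⟩,
    Raised (bump B ε), inferInstance, Raised.homeo (bump B ε), Raised.edist_eq,
    fun i => point (Raised.homeo (bump B ε)) B (some i),
    Raised.homeo (bump B ε) ⁻¹' closedCell (hexagon B), hr.isPolygon, fun x hx => ?_, ?_⟩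
  · rw [← hBn, bump_apply_basis]
    norm_num
  · refine bump_eq_one hε ?_
    by_contra! hlt
    refine hx (hU' ?_)
    rw [Metric.mem_ball, dist_eq_norm, ← hBn]
    exact hlt.trans_le (min_le_right _ _)
  · rw [← hBn]
    exact height_pos_of_mem_hexagon hx
  · have hS : insert ((Raised.homeo (bump B ε)).symm (-n))
        (range fun i => point (Raised.homeo (bump B ε)) B (some i)) =
        range (point (Raised.homeo (bump B ε)) B) := by
      have hpole : node B none = -n := Subtype.ext (by rw [coe_node_none, hBn]; rfl)
      ext x
      constructor
      · rintro (rfl | ⟨i, rfl⟩)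
        · exact ⟨none, by rw [point, hpole]⟩
        · exact ⟨some i, rfl⟩
      · rintro ⟨_ | i, rfl⟩
        · exact Or.inl (by rw [point, hpole])
        · exact Or.inr ⟨i, rfl⟩
    obtain ⟨a1, a2, a3⟩ := hr.polygonTG_eq_bot rfl
    obtain ⟨b1, b2, b3⟩ := hr.pointSetTG_eq_bot hS
    exact ⟨a1, a2, a3, b1, b2, b3⟩
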